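/- **Setting.** Let $\mathbb R_+=[0,\infty)$ and let $X=L_\infty(\mathbb R_+)\cap W^1_{\infty,\mathrm{loc}}(\mathbb R_+)$ (bounded kernels, Lipschitz on compact subsets of $[0,\infty)$, identified with their continuous versions). Fix $d$, $T>0$, $a\in X$ and a compactly supported probability measure $\mu_0$ on $\mathbb R^d$. For a kernel $b$ put $F^{[b]}(z)=-b(|z|)z$, $z\in\mathbb R^d$, and $(f*\mu)(x)=\int f(x-y)\,d\mu(y)$. Let $\mu:[0,T]\to\mathcal P_1(\mathbb R^d)$ be the weak solution of $\partial_t\mu=-\nabla\cdot\big((F^{[a]}*\mu)\mu\big)$, $\mu(0)=\mu_0$; that is, $\mu$ has uniformly compact support, is continuous for the Wasserstein distance $\mathcal W_1$, and $\frac{d}{dt}\int\phi\,d\mu(t)=\int\nabla\phi\cdot(F^{[a]}*\mu(t))\,d\mu(t)$ for all $\phi\in C_c^\infty(\mathbb R^d)$. Let $R>0$ be such that $\operatorname{supp}\mu(t)\subseteq \overline B(0,R)$ for $t\in[0,T]$ and, for every $N$, every solution on $[0,T]$ of the particle system $\dot x_i=\frac1N\sum_{j=1}^N F^{[a]}(x_i-x_j)$,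 $i=1,\dots,N$, with initial points in $\operatorname{supp}\mu_0$ stays in $\overline B(0,R)$. Put $K=[0,2R]$, let $M>0$ satisfy $M\ge\|a\|_{L_\infty(K)}+\|a'\|_{L_\infty(K)}$, and let $X_{M,K}=\{b\in W^1_\infty(K):\|b\|_{L_\infty(K)}+\|b'\|_{L_\infty(K)}\le M\}$. For every $N\ge1$ let $x_{0,1}^N,\dots,x_{0,N}^N$ be independent with law $\mu_0$, let $\mu_0^N=\frac1N\sum_i\delta_{x^N_{0,i}}$, and let $x_1,\dots,x_N$ be the solution of the particle system with these initial points. Define $$\mathcal E^{[a],N}(b)=\frac1T\int_0^T\frac1N\sum_{i=1}^N\Big|\frac1N\sum_{j=1}^N(F^{[b]}-F^{[a]})(x_i(t)-x_j(t))\Big|^2dt,$$ $$\mathcal E^{[a]}(b)=\frac1T\int_0^T\int\big|\big((F^{[b]}-F^{[a]})*\mu(t)\big)(x)\big|^2\,d\mu(t)(x)\,dt.$$ Let $\varrho(t)$ be the image of $\mu(t)\otimes\mu(t)$ under $(x,y)\mapsto|x-y|$, let $\overline\rho=\frac1T\int_0^T\varrho(t)\,dt$ and $\rho(A)=\int_A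 s^2\,d\overline\rho(s)$. The *coercivity condition* with constant $c_T>0$ is: $c_T\|b-a\|^2_{L_2(\mathbb R_+,\rho)}\le\mathcal E^{[a]}(b)$ for all $b\in X\cap L_2(\mathbb R_+,\rho)$. Sets $V_N\subset X_{M,K}$, $N\ge1$, have the *uniform approximation property* if for each $b\in X_{M,K}$ there are $b_N\in V_N$ ($N\ge1$) converging to $b$ uniformly on $K$. **Theorem 1.3.** (i) Almost surely the following holds. For all sets $V_N\subset X_{M,K}$ with the uniform approximation property and all minimizers $\widehat a_N\in\operatorname{argmin}_{b\in V_N}\mathcal E^{[a],N}(b)$, $N\ge1$, the sequence $(\widehat a_N)$ has a subsequence converging uniformly on $K$ to some continuous $\widehat a\in X_{M,K}$ with $\mathcal E^{[a]}(\widehat a)=0$. If moreover the coercivity condition holds for some $c_T>0$, then $\widehat a=a$ in $L_2(\mathbb R_+,\rho)$. (ii) Assume the coercivity condition with some $c_T>0$, and let $\alpha,\beta,C_1,C_2>0$. Then there is a constant $C_3>0$, independent of $N$, of the realization and of the choice of $V_N$, $\widehat a_N$ and $a_N$, such that almost surely the following holds. If $V_N$ and $\widehat a_N$ are as in (i), if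 $a_N\in V_N$ satisfy $\|a-a_N\|_{L_\infty(K)}\le C_1N^{-\alpha}$ for all $N\ge1$, and if the realization satisfies $\mathcal W_1(\mu_0^N,\mu_0)\le C_2N^{-\beta}$ for all $N\ge1$, then $$\|a-\widehat a_N\|^2_{L_2(\mathbb R_+,\rho)}\le C_3N^{-\min\{\alpha,\beta\}}\qquad\text{for all }N\ge1,$$ and in particular the whole sequence $(\widehat a_N)$ converges to $a$ in $L_2(\mathbb R_+,\rho)$. -/

import Mathlib

open MeasureTheory ProbabilityTheory Set Filter Topology
open scoped ENNReal

namespace KernelLearning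

/-! ### Kernels on the half-line -/

/-- `g` is the weak (distributional) derivative of `b` on the open set `U ⊆ ℝ`:
both are locally integrable on `U` and `∫ b φ' = - ∫ g φ` for all `φ ∈ C_c^∞(U)`. -/
def HasWeakDerivOn (b g : ℝ → ℝ) (U : Set ℝ) : Prop :=
  LocallyIntegrableOn b U volume ∧ LocallyIntegrableOn g U volume ∧
    ∀ φ : ℝ → ℝ, ContDiff ℝ (⊤ : ℕ∞) φ → HasCompactSupport φ → tsupport φ ⊆ U →
      ∫ s, b s * deriv φ s = - ∫ s, g s * φ s

/-- The `L_∞(S)`-norm (essential supremum for Lebesgue measure) of a function on `S ⊆ ℝ`. -/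
noncomputable def supNormOn (b : ℝ → ℝ) (S : Set ℝ) : ℝ≥0∞ :=
  eLpNorm b ∞ (volume.restrict S)

/-- The set `X = L_∞(ℝ₊) ∩ W^1_{∞,loc}(ℝ₊)` of admissible kernels, `ℝ₊ = [0, ∞)`; here a kernel is
represented by its continuous version, and "loc" refers to compact subsets of `[0, ∞)`.
Values at negative arguments are never used. -/
def Admissible : Set (ℝ → ℝ) :=
  {b | ContinuousOn b (Ici 0) ∧ supNormOn b (Ici 0) < ∞ ∧
    ∃ g : ℝ → ℝ, HasWeakDerivOn b g (Ioi 0) ∧ ∀ r : ℝ, supNormOn g (Icc 0 r) < ∞}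

/-- The set `X_{M,K}`, `K = [0, 2R]`, of the `b ∈ W^1_∞(K)` (in their continuous version) with
`‖b‖_{L_∞(K)} + ‖b'‖_{L_∞(K)} ≤ M`. Only the values on `K` matter. -/
def BoundedKernels (M R : ℝ) : Set (ℝ → ℝ) :=
  {b | ContinuousOn b (Icc 0 (2 * R)) ∧
    ∃ g : ℝ → ℝ, HasWeakDerivOn b g (Ioo 0 (2 * R)) ∧
      supNormOn b (Icc 0 (2 * R)) + supNormOn g (Icc 0 (2 * R)) ≤ ENNReal.ofReal M}

/-- `V N ⊆ X_{M,K}` (`N ≥ 1`, `K = [0, 2R]`) has the uniform approximation property: each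
`b ∈ X_{M,K}` is the uniform limit on `K` of some `b_N ∈ V N`. (The sets need not be closed.) -/
def UniformApproximationProperty (M R : ℝ) (V : ℕ → Set (ℝ → ℝ)) : Prop :=
  (∀ N, 1 ≤ N → V N ⊆ BoundedKernels M R) ∧
    ∀ b ∈ BoundedKernels M R, ∃ bN : ℕ → ℝ → ℝ, (∀ N, 1 ≤ N → bN N ∈ V N) ∧
      TendstoUniformlyOn bN b atTop (Icc 0 (2 * R))

/-! ### Dynamics -/

section Dynamics

variable {d : ℕ}

/-- The interaction force `F^{[a]}(z) = - a(|z|) z`. -/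
noncomputable def force (a : ℝ → ℝ) (z : EuclideanSpace ℝ (Fin d)) : EuclideanSpace ℝ (Fin d) :=
  -(a ‖z‖ • z)

/-- The convolution `(f * μ)(x) = ∫ f(x - y) dμ(y)`. -/
noncomputable def conv (f : EuclideanSpace ℝ (Fin d) → EuclideanSpace ℝ (Fin d))
    (μ : Measure (EuclideanSpace ℝ (Fin d))) (x : EuclideanSpace ℝ (Fin d)) :
    EuclideanSpace ℝ (Fin d) :=
  ∫ y, f (x - y) ∂μ

/-- The Wasserstein distance `𝒲₁(μ, ν)`: the infimum of `∫ |x - y| dπ(x, y)` over all couplings. -/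
noncomputable def W₁ (μ ν : Measure (EuclideanSpace ℝ (Fin d))) : ℝ≥0∞ :=
  ⨅ (π : Measure (EuclideanSpace ℝ (Fin d) × EuclideanSpace ℝ (Fin d)))
    (_ : π.fst = μ ∧ π.snd = ν), ∫⁻ p, edist p.1 p.2 ∂π

/-- The empirical measure `(1/N) ∑ᵢ δ_{xᵢ}`. -/
noncomputable def empiricalMeasure {N : ℕ} (x : Fin N → EuclideanSpace ℝ (Fin d)) :
    Measure (EuclideanSpace ℝ (Fin d)) :=
  (N : ℝ≥0∞)⁻¹ • ∑ i, Measure.dirac (x i)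

/-- `x = (x₁, …, x_N)` solves `ẋᵢ = (1/N) ∑ⱼ F^{[a]}(xᵢ - xⱼ)` on `[0, T]` with `xᵢ(0) = x₀ᵢ`. -/
def IsParticleSolution (a : ℝ → ℝ) (T : ℝ) {N : ℕ} (x₀ : Fin N → EuclideanSpace ℝ (Fin d))
    (x : Fin N → ℝ → EuclideanSpace ℝ (Fin d)) : Prop :=
  (∀ i, x i 0 = x₀ i) ∧
    ∀ i, ∀ t ∈ Icc 0 T,
      HasDerivWithinAt (x i) ((N : ℝ)⁻¹ • ∑ j, force a (x i t - x j t)) (Icc 0 T) t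

/-- `μ : [0, T] → 𝒫₁(ℝᵈ)` is a weak solution of `∂ₜμ = - ∇·((F^{[a]} * μ) μ)`, `μ(0) = μ₀`. -/
structure IsMeanFieldSolution (a : ℝ → ℝ) (T : ℝ) (μ₀ : Measure (EuclideanSpace ℝ (Fin d)))
    (μ : ℝ → Measure (EuclideanSpace ℝ (Fin d))) : Prop where
  isProbabilityMeasure : ∀ t ∈ Icc 0 T, IsProbabilityMeasure (μ t)
  initial : μ 0 = μ₀
  /-- uniformly compact support -/
  support : ∃ r : ℝ, 0 < r ∧ ∀ t ∈ Icc 0 T, (μ t).support ⊆ Metric.closedBall 0 r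
  /-- continuity for `𝒲₁` -/
  continuous : ∀ t ∈ Icc 0 T, Tendsto (fun s => W₁ (μ s) (μ t)) (𝓝[Icc 0 T] t) (𝓝 0)
  /-- the equation, tested with `φ ∈ C_c^∞(ℝᵈ)`; `fderiv ℝ φ x v` is `∇φ(x) · v` -/
  weak : ∀ φ : EuclideanSpace ℝ (Fin d) → ℝ, ContDiff ℝ (⊤ : ℕ∞) φ → HasCompactSupport φ →
    ∀ t ∈ Ioc 0 T, HasDerivWithinAt (fun s => ∫ x, φ x ∂(μ s))
      (∫ x, fderiv ℝ φ x (conv (force a) (μ t) x) ∂(μ t)) (Icc 0 T) t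

/-- `R > 0` is such that all particle trajectories (of any number of particles) issued from
points of `supp μ₀`, and the mean-field solution issued from `μ₀`, stay in the closed ball
`B(0, R)` during `[0, T]`. -/
structure IsConfiningRadius (a : ℝ → ℝ) (T : ℝ) (μ₀ : Measure (EuclideanSpace ℝ (Fin d)))
    (R : ℝ) : Prop where
  pos : 0 < R
  particles : ∀ (N : ℕ) (x₀ : Fin N → EuclideanSpace ℝ (Fin d)), (∀ i, x₀ i ∈ μ₀.support) →
    ∀ x : Fin N → ℝ → EuclideanSpace ℝ (Fin d), IsParticleSolution a T x₀ x →
      ∀ i, ∀ t ∈ Icc 0 T, x i t ∈ Metric.closedBall 0 R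
  meanField : ∀ μ : ℝ → Measure (EuclideanSpace ℝ (Fin d)), IsMeanFieldSolution a T μ₀ μ →
    ∀ t ∈ Icc 0 T, (μ t).support ⊆ Metric.closedBall 0 R

/-! ### Error functionals, the measure `ρ`, coercivity -/

/-- `ℰ^{[a]}(b) = (1/T) ∫₀ᵀ ∫ |((F^{[b]} - F^{[a]}) * μ(t))(x)|² dμ(t)(x) dt`, with values in
`[0, ∞]`, for a curve of measures `μ`. -/
noncomputable def errorFunctional (a : ℝ → ℝ) (T : ℝ)
    (μ : ℝ → Measure (EuclideanSpace ℝ (Fin d))) (b : ℝ → ℝ) : ℝ≥0∞ :=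
  (ENNReal.ofReal T)⁻¹ * ∫⁻ t in Icc 0 T, ∫⁻ x,
    ‖conv (fun z => force b z - force a z) (μ t) x‖ₑ ^ 2 ∂(μ t)

/-- The discrete error functional
`ℰ^{[a],N}(b) = (1/T) ∫₀ᵀ (1/N) ∑ᵢ |(1/N) ∑ⱼ (F^{[b]} - F^{[a]})(xᵢ(t) - xⱼ(t))|² dt`
of the trajectories `x`. -/
noncomputable def discreteErrorFunctional (a : ℝ → ℝ) (T : ℝ) {N : ℕ}
    (x : Fin N → ℝ → EuclideanSpace ℝ (Fin d)) (b : ℝ → ℝ) : ℝ≥0∞ :=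
  (ENNReal.ofReal T)⁻¹ * ∫⁻ t in Icc 0 T, (N : ℝ≥0∞)⁻¹ * ∑ i,
    ‖(N : ℝ)⁻¹ • ∑ j, (force b (x i t - x j t) - force a (x i t - x j t))‖ₑ ^ 2

/-- `ϱ(t)`, the law of `|x - y|` under `μ(t) ⊗ μ(t)`. -/
noncomputable def distanceLaw (μ : ℝ → Measure (EuclideanSpace ℝ (Fin d))) (t : ℝ) : Measure ℝ :=
  ((μ t).prod (μ t)).map (fun p => dist p.1 p.2)

/-- The time average `ρ̄(A) = (1/T) ∫₀ᵀ ϱ(t)(A) dt`. -/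
noncomputable def averagedDistanceLaw (T : ℝ) (μ : ℝ → Measure (EuclideanSpace ℝ (Fin d))) :
    Measure ℝ :=
  (ENNReal.ofReal T)⁻¹ • Measure.bind (volume.restrict (Icc 0 T)) (distanceLaw μ)

/-- The weighted measure `ρ(A) = ∫_A s² dρ̄(s)`; it is concentrated on `[0, ∞)`. -/
noncomputable def rho (T : ℝ) (μ : ℝ → Measure (EuclideanSpace ℝ (Fin d))) : Measure ℝ :=
  (averagedDistanceLaw T μ).withDensity (fun s => ENNReal.ofReal (s ^ 2))

/-- The coercivity condition `c ‖b - a‖²_{L₂(ℝ₊,ρ)} ≤ ℰ^{[a]}(b)` for all `b ∈ X ∩ L₂(ℝ₊,ρ)`. -/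
def Coercive (a : ℝ → ℝ) (T : ℝ) (μ : ℝ → Measure (EuclideanSpace ℝ (Fin d))) (c : ℝ) : Prop :=
  ∀ b ∈ Admissible, MemLp b 2 (rho T μ) →
    ENNReal.ofReal c * eLpNorm (fun s => b s - a s) 2 (rho T μ) ^ 2 ≤ errorFunctional a T μ b

end Dynamics

end KernelLearning

open KernelLearning

namespace KernelLearning

open scoped NNReal

/-! ### Weak derivatives on the line -/

/-! The minimizer is compared with `a`, whose error is zero. The discrete functional is the
continuous one evaluated along the empirical curve (`discreteErrorFunctional_eq`), and that curve is
itself a weak solution driven by the same force (`IsParticleSolution.weakCurve`). If the initial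
data are at Kantorovich distance at most δ and some `a_N ∈ V_N` is within ε of `a` on `K`, then
`ℰ(â_N) ≤ ℰ^N(â_N) + Cδ ≤ ℰ^N(a_N) + Cδ ≤ 2(2Rε)² + Cδ`, by stability of the curves, minimality, and
continuity of the functional in the kernel. This is `errorFunctional_le_of_isMinOn`; its constant
`C` is uniform over `X_{M,K}`.

Part (ii) inserts ε = C₁N^{-α} and δ = C₂N^{-β} and divides by the coercivity constant. For part
(i), δ → 0 almost surely by a law of large numbers for the empirical measures
(`ae_eventually_kantorovichLE`), ε → 0 by the approximation property, and Arzelà–Ascoli gives a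
uniformly convergent subsequence (`exists_subseq_tendstoUniformlyOn`), along which the functional
passes to the limit.

Stability (`WeakCurve.stability`) uses no characteristics, only integrals of test functions. An
Euler step of length h reproduces the evolution of a smooth integral up to O(h²), and composition
with the step turns a K-Lipschitz test function into a K(1 + hL)-Lipschitz one. Iterating gives a
discrete Gronwall estimate. Since the O(h²) term needs second-order control, test functions are
mollified at scale ε; first h → 0, then ε → 0. With distances measured by Lipschitz test functions,
only the easy half of Kantorovich duality is needed.

All points stay in the ball of radius `R`, so only kernel values on `[0, 2R]` matter. Kernels are
replaced by their constant extensions beyond this interval, which makes the forces globally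
Lipschitz. -/

lemma HasWeakDerivOn.mono {b g : ℝ → ℝ} {U V : Set ℝ} (h : HasWeakDerivOn b g U) (hVU : V ⊆ U) :
    HasWeakDerivOn b g V :=
  ⟨h.1.mono_set hVU, h.2.1.mono_set hVU, fun φ h1 h2 h3 => h.2.2 φ h1 h2 (h3.trans hVU)⟩

lemma HasWeakDerivOn.congr {b b₁ g : ℝ → ℝ} {U : Set ℝ} (h : HasWeakDerivOn b g U)
    (hU : MeasurableSet U) (hb : EqOn b b₁ U) : HasWeakDerivOn b₁ g U := by
  refine ⟨?_, h.2.1, fun φ h1 h2 h3 => ?_⟩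
  · intro x hx
    obtain ⟨s, hs, hi⟩ := h.1 x hx
    refine ⟨s ∩ U, inter_mem hs self_mem_nhdsWithin, ?_⟩
    refine (hi.mono_set inter_subset_left).congr ?_
    have hsub : ∀ᵐ y ∂(volume.restrict U), b y = b₁ y :=
      (ae_restrict_mem hU).mono fun y hy => hb hy
    exact ae_mono (Measure.restrict_mono inter_subset_right le_rfl) hsub
  · rw [← h.2.2 φ h1 h2 h3]
    congr 1 with s
    by_cases hs : s ∈ tsupport φ
    · rw [hb (h3 hs)]
    · have : deriv φ s = 0 := by
        by_contra hne
        exact hs (support_deriv_subset (𝕜 := ℝ) hne)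
      simp [this]

/-- A globally Lipschitz function has its classical derivative as weak derivative. -/
lemma hasWeakDerivOn_deriv_of_lipschitzWith {b : ℝ → ℝ} {L : ℝ≥0} (hb : LipschitzWith L b)
    (U : Set ℝ) : HasWeakDerivOn b (deriv b) U := by
  have hline : ∀ f : ℝ → ℝ, ∀ x, lineDeriv ℝ f x 1 = deriv f x := by
    intro f x
    simp only [lineDeriv, smul_eq_mul, mul_one]
    have := deriv_comp_const_add (f := f) x 0
    simpa using this
  have hline' : ∀ f : ℝ → ℝ, ∀ x, lineDeriv ℝ f x (-1) = - deriv f x := by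
    intro f x
    rw [lineDeriv_neg, hline]
  refine ⟨hb.continuous.locallyIntegrable.locallyIntegrableOn U, ?_, fun φ h1 h2 _ => ?_⟩
  · have := (hb.locallyIntegrable_lineDeriv (μ := volume) (1 : ℝ)).locallyIntegrableOn U
    simpa only [hline] using this
  · obtain ⟨D, hD⟩ := ContDiff.lipschitzWith_of_hasCompactSupport h2 h1 (by simp)
    have := hb.integral_lineDeriv_mul_eq (μ := volume) hD h2 (1 : ℝ)
    simp only [hline, hline'] at this
    rw [this, ← integral_neg]
    congr 1 with x
    ring

/-- A continuous function whose weak derivative is bounded by `L` on an interval is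
`L`-Lipschitz there. -/
lemma HasWeakDerivOn.dist_le_of_mem_Ioo {b g : ℝ → ℝ} {r L : ℝ} (hb : Continuous b)
    (h : HasWeakDerivOn b g (Ioo 0 r))
    (hg : ∀ᵐ s ∂volume, s ∈ Ioo 0 r → |g s| ≤ L) {s t : ℝ} (hs : s ∈ Ioo 0 r) (ht : t ∈ Ioo 0 r) :
    |b s - b t| ≤ L * |s - t| := by
  let η : ℕ → ContDiffBump (0 : ℝ) := fun n =>
    ⟨1 / (n + 2), 1 / (n + 1), by positivity, by
      apply one_div_lt_one_div_of_lt <;> [positivity; linarith]⟩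
  have hη : Tendsto (fun n => (η n).rOut) atTop (𝓝 0) := tendsto_one_div_add_atTop_nhds_zero_nat
  let bn : ℕ → ℝ → ℝ := fun n =>
    MeasureTheory.convolution ((η n).normed volume) b (ContinuousLinearMap.lsmul ℝ ℝ) volume
  have hlim : ∀ x, Tendsto (fun n => bn n x) atTop (𝓝 (b x)) := fun x =>
    ContDiffBump.convolution_tendsto_right_of_continuous hη hb x
  -- The derivative of the mollification at `x` is the average of `g` against the probability
  -- density `φ y = η (x - y)`, supported where `|g| ≤ L`. Hence `|bn'| ≤ L`, and the mean value
  -- bound survives the limit.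
  have key : ∀ n, ∀ x, Metric.closedBall x (η n).rOut ⊆ Ioo 0 r →
      ∃ D, |D| ≤ L ∧ HasDerivAt (bn n) D x := by
    intro n x hx
    refine ⟨_, ?_, HasCompactSupport.hasDerivAt_convolution_left (ContinuousLinearMap.lsmul ℝ ℝ)
      (η n).hasCompactSupport_normed ((η n).contDiff_normed (n := 1)) hb.locallyIntegrable x⟩
    rw [convolution_lsmul_swap]
    let φ : ℝ → ℝ := fun y => (η n).normed volume (x - y)
    have hφs : ContDiff ℝ (⊤ : ℕ∞) φ :=
      ((η n).contDiff_normed (n := (⊤ : ℕ∞))).comp (contDiff_const.sub contDiff_id)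
    have hφd : ∀ y, deriv φ y = - deriv ((η n).normed volume) (x - y) := fun y => by
      simpa using deriv_comp_const_sub (f := (η n).normed volume) x y
    have hφ0 : ∀ y, y ∉ Metric.closedBall x (η n).rOut → φ y = 0 := by
      intro y hy
      have : x - y ∉ Function.support ((η n).normed volume) := by
        rw [(η n).support_normed_eq]
        intro hm
        apply hy
        rw [Metric.mem_closedBall, Real.dist_eq, abs_sub_comm]
        rw [mem_ball_zero_iff, Real.norm_eq_abs] at hm
        exact hm.le
      simpa using this
    have hφc : tsupport φ ⊆ Metric.closedBall x (η n).rOut := by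
      refine closure_minimal (fun y hy => ?_) Metric.isClosed_closedBall
      by_contra hc
      exact hy (hφ0 y hc)
    have hφk : HasCompactSupport φ :=
      HasCompactSupport.intro (isCompact_closedBall x _) hφ0
    have e := h.2.2 φ hφs hφk (hφc.trans hx)
    have e2 : ∫ y, deriv ((η n).normed volume) (x - y) • b y = ∫ y, g y * φ y := by
      have : ∫ y, b y * deriv φ y = - ∫ y, deriv ((η n).normed volume) (x - y) • b y := by
        rw [← integral_neg]; congr 1 with y; rw [hφd, smul_eq_mul]; ring
      linarith
    rw [e2]
    have hφint : ∫ y, φ y = 1 := by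
      rw [← (η n).integral_normed (μ := volume)]
      exact integral_sub_left_eq_self (fun z => (η n).normed volume z) volume x
    have hφI : Integrable φ := hφs.continuous.integrable_of_hasCompactSupport hφk
    calc |∫ y, g y * φ y| ≤ ∫ y, L * φ y := by
          rw [← Real.norm_eq_abs]
          refine norm_integral_le_of_norm_le (hφI.const_mul L) ?_
          filter_upwards [hg] with y hy
          by_cases hyc : y ∈ Metric.closedBall x (η n).rOut
          · have h0 : 0 ≤ φ y := (η n).nonneg_normed _
            rw [norm_mul, Real.norm_eq_abs, Real.norm_eq_abs, abs_of_nonneg h0]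
            exact mul_le_mul_of_nonneg_right (hy (hx hyc)) h0
          · simp [hφ0 y hyc]
      _ = L := by rw [integral_const_mul, hφint, mul_one]
  have hev : ∀ᶠ n in atTop, |bn n s - bn n t| ≤ L * |s - t| := by
    have hm : 0 < min (min s t) (r - max s t) := by
      simp only [mem_Ioo] at hs ht
      simp only [lt_min_iff, sub_pos, max_lt_iff]
      exact ⟨⟨hs.1, ht.1⟩, hs.2, ht.2⟩
    filter_upwards [hη.eventually (gt_mem_nhds hm)] with n hn
    have hsub : ∀ x ∈ uIcc s t, Metric.closedBall x (η n).rOut ⊆ Ioo 0 r := by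
      intro x hx y hy
      rw [Metric.mem_closedBall, Real.dist_eq, abs_le] at hy
      rw [uIcc, mem_Icc] at hx
      rw [lt_min_iff] at hn
      constructor
      · linarith [hx.1, hn.1]
      · linarith [hx.2, hn.2]
    choose! D hD hD' using fun x hx => key n x (hsub x hx)
    have := Convex.norm_image_sub_le_of_norm_hasDerivWithin_le (𝕜 := ℝ) (f := bn n) (f' := D)
      (C := L) (s := uIcc s t) (fun x hx => (hD' x hx).hasDerivWithinAt) hD (convex_uIcc s t)
      right_mem_uIcc left_mem_uIcc
    simpa using this
  have hl := ((hlim s).sub (hlim t)).abs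
  exact le_of_tendsto hl hev

/-! ### Essential suprema and pointwise bounds -/

lemma ae_norm_le_toReal_supNormOn {b : ℝ → ℝ} {S : Set ℝ} (h : supNormOn b S ≠ ∞) :
    ∀ᵐ s ∂(volume.restrict S), |b s| ≤ (supNormOn b S).toReal := by
  have := ae_le_eLpNormEssSup (f := b) (μ := volume.restrict S)
  filter_upwards [this] with s hs
  rw [← eLpNorm_exponent_top] at hs
  have h2 := ENNReal.toReal_mono h hs
  simpa using h2

lemma supNormOn_le_ofReal {b : ℝ → ℝ} {S : Set ℝ} {C : ℝ} (hS : MeasurableSet S)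
    (h : ∀ s ∈ S, |b s| ≤ C) : supNormOn b S ≤ ENNReal.ofReal C := by
  rw [supNormOn, eLpNorm_exponent_top]
  refine eLpNormEssSup_le_of_ae_bound ?_
  exact (ae_restrict_mem hS).mono fun s hs => h s hs

/-- A closed condition which holds almost everywhere on an interval holds everywhere on it. -/
lemma abs_le_of_ae_restrict_Icc {b : ℝ → ℝ} {r C : ℝ} (hr : 0 < r) (hb : ContinuousOn b (Icc 0 r))
    (h : ∀ᵐ s ∂(volume.restrict (Icc 0 r)), |b s| ≤ C) : ∀ s ∈ Icc 0 r, |b s| ≤ C := by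
  have hd : Icc 0 r ⊆ closure {s | s ∈ Ioo 0 r ∧ |b s| ≤ C} := by
    have h1 : Ioo 0 r ⊆ closure {s | s ∈ Ioo 0 r ∧ |b s| ≤ C} := by
      intro s hs
      rw [mem_closure_iff]
      intro o ho hso
      have hpos : 0 < volume (o ∩ Ioo 0 r) :=
        (ho.inter isOpen_Ioo).measure_pos volume ⟨s, hso, hs⟩
      rw [ae_restrict_iff' measurableSet_Icc] at h
      by_contra hne
      rw [not_nonempty_iff_eq_empty] at hne
      have : o ∩ Ioo 0 r ⊆ {s | ¬ (s ∈ Icc 0 r → |b s| ≤ C)} := by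
        rintro y ⟨hy1, hy2⟩ hy3
        have : y ∈ o ∩ {s | s ∈ Ioo 0 r ∧ |b s| ≤ C} := ⟨hy1, hy2, hy3 (Ioo_subset_Icc_self hy2)⟩
        rw [hne] at this
        exact this
      have := measure_mono_null this h
      exact hpos.ne' this
    rw [← closure_Ioo hr.ne]
    exact closure_minimal h1 isClosed_closure
  intro s hs
  have hcw : ContinuousWithinAt (fun s => |b s|) (Icc 0 r) s := (hb s hs).abs
  have hcl : s ∈ closure {s | s ∈ Ioo 0 r ∧ |b s| ≤ C} := hd hs
  have := ContinuousWithinAt.mem_closure (f := fun s => |b s|) (t := Iic C)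
    (hcw.mono (s := {s | s ∈ Ioo 0 r ∧ |b s| ≤ C}) fun y hy => Ioo_subset_Icc_self hy.1) hcl
    fun y hy => hy.2
  simpa using this

/-! ### Kernels as bounded Lipschitz functions on an interval -/

/-- The continuous extension of `b` from `[0, r]` that is constant on both sides. -/
noncomputable def clampExtend (r : ℝ) (b : ℝ → ℝ) (s : ℝ) : ℝ := b (max 0 (min s r))

lemma clampExtend_eqOn {r : ℝ} (b : ℝ → ℝ) : EqOn b (clampExtend r b) (Icc 0 r) := by
  intro s hs
  simp [clampExtend, min_eq_left hs.2, max_eq_right hs.1]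

lemma clamp_mem {r : ℝ} (hr : 0 < r) (s : ℝ) : max 0 (min s r) ∈ Icc 0 r :=
  ⟨le_max_left _ _, max_le hr.le (min_le_right _ _)⟩

lemma continuous_clampExtend {r : ℝ} (hr : 0 < r) {b : ℝ → ℝ} (hb : ContinuousOn b (Icc 0 r)) :
    Continuous (clampExtend r b) :=
  hb.comp_continuous (continuous_const.max (continuous_id.min continuous_const)) (clamp_mem hr)

lemma abs_clamp_sub_le {r : ℝ} (s t : ℝ) : |max 0 (min s r) - max 0 (min t r)| ≤ |s - t| := by
  have h1 := abs_max_sub_max_le_abs (min s r) (min t r) 0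
  have h2 := abs_min_sub_min_le_max s r t r
  rw [max_comm, max_comm 0]
  simp only [sub_self, abs_zero] at h2
  exact h1.trans (h2.trans (by simp))

/-- `b` is bounded by `S` and `L`-Lipschitz on `[0, r]`. -/
structure BoundedLipschitz (r S L : ℝ) (b : ℝ → ℝ) : Prop where
  nonneg_bound : 0 ≤ S
  nonneg_lip : 0 ≤ L
  bound : ∀ s ∈ Icc 0 r, |b s| ≤ S
  lip : ∀ s ∈ Icc 0 r, ∀ t ∈ Icc 0 r, |b s - b t| ≤ L * |s - t|

lemma BoundedLipschitz.continuousOn {r S L : ℝ} {b : ℝ → ℝ} (h : BoundedLipschitz r S L b) :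
    ContinuousOn b (Icc 0 r) := by
  have : LipschitzOnWith ⟨L, h.nonneg_lip⟩ b (Icc 0 r) :=
    LipschitzOnWith.of_dist_le_mul fun s hs t ht => h.lip s hs t ht
  exact this.continuousOn

lemma BoundedLipschitz.lipschitzWith {r S L : ℝ} (hr : 0 < r) {b : ℝ → ℝ}
    (h : BoundedLipschitz r S L b) : LipschitzWith ⟨L, h.nonneg_lip⟩ (clampExtend r b) :=
  LipschitzWith.of_dist_le_mul fun s t =>
    (h.lip _ (clamp_mem hr s) _ (clamp_mem hr t)).trans
      (mul_le_mul_of_nonneg_left (abs_clamp_sub_le s t) h.nonneg_lip)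

/-- `S` and `L` are the two essential suprema themselves, so the bound on their sum is kept. The
Lipschitz estimate holds on the open interval and extends to its closure by continuity; the clamped
extension supplies the global continuity required by the mollification argument. -/
lemma HasWeakDerivOn.boundedLipschitz {b g : ℝ → ℝ} {r M : ℝ} (hr : 0 < r)
    (hb : ContinuousOn b (Icc 0 r)) (h : HasWeakDerivOn b g (Ioo 0 r))
    (hM0 : 0 ≤ M) (hM : supNormOn b (Icc 0 r) + supNormOn g (Icc 0 r) ≤ ENNReal.ofReal M) :
    ∃ S L, S + L ≤ M ∧ BoundedLipschitz r S L b := by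
  have hfin : supNormOn b (Icc 0 r) + supNormOn g (Icc 0 r) ≠ ∞ :=
    ne_top_of_le_ne_top ENNReal.ofReal_ne_top hM
  rw [ENNReal.add_ne_top] at hfin
  refine ⟨(supNormOn b (Icc 0 r)).toReal, (supNormOn g (Icc 0 r)).toReal, ?_,
    ENNReal.toReal_nonneg, ENNReal.toReal_nonneg, ?_, ?_⟩
  · rw [← ENNReal.toReal_add hfin.1 hfin.2]
    exact ENNReal.toReal_le_of_le_ofReal hM0 hM
  · exact abs_le_of_ae_restrict_Icc hr hb (ae_norm_le_toReal_supNormOn hfin.1)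
  · set L := (supNormOn g (Icc 0 r)).toReal
    have hg : ∀ᵐ s ∂volume, s ∈ Ioo 0 r → |g s| ≤ L := by
      have := ae_norm_le_toReal_supNormOn hfin.2
      rw [ae_restrict_iff' measurableSet_Icc] at this
      exact this.mono fun s hs h => hs (Ioo_subset_Icc_self h)
    have hc := continuous_clampExtend hr hb
    have hw := h.congr measurableSet_Ioo
      ((clampExtend_eqOn b).mono Ioo_subset_Icc_self)
    have h1 : ∀ s ∈ Ioo 0 r, ∀ t ∈ Ioo 0 r,
        dist (clampExtend r b s) (clampExtend r b t) ≤ (⟨L, ENNReal.toReal_nonneg⟩ : ℝ≥0) * dist s t :=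
      fun s hs t ht => hw.dist_le_of_mem_Ioo hc hg hs ht
    have h2 := (LipschitzOnWith.of_dist_le_mul h1).closure hc.continuousOn
    rw [closure_Ioo hr.ne] at h2
    intro s hs t ht
    rw [clampExtend_eqOn b hs, clampExtend_eqOn b ht]
    exact h2.dist_le_mul s hs t ht

lemma supNormOn_deriv_clampExtend_le {r S L : ℝ} (hr : 0 < r) {b : ℝ → ℝ}
    (h : BoundedLipschitz r S L b) {U : Set ℝ} (hU : MeasurableSet U) :
    supNormOn (deriv (clampExtend r b)) U ≤ ENNReal.ofReal L :=
  supNormOn_le_ofReal hU fun _ _ => norm_deriv_le_of_lipschitz (h.lipschitzWith hr)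

lemma BoundedLipschitz.mem_boundedKernels {R S L M : ℝ} (hR : 0 < R) {b : ℝ → ℝ}
    (h : BoundedLipschitz (2 * R) S L b) (hM : S + L ≤ M) : b ∈ BoundedKernels M R := by
  have hr : 0 < 2 * R := by linarith
  refine ⟨h.continuousOn, deriv (clampExtend (2 * R) b), ?_, ?_⟩
  · exact (hasWeakDerivOn_deriv_of_lipschitzWith (h.lipschitzWith hr) _).congr measurableSet_Ioo
      ((clampExtend_eqOn b).symm.mono Ioo_subset_Icc_self)
  · calc _ ≤ ENNReal.ofReal S + ENNReal.ofReal L :=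
          add_le_add (supNormOn_le_ofReal measurableSet_Icc h.bound)
            (supNormOn_deriv_clampExtend_le hr h measurableSet_Icc)
      _ ≤ _ := by
          rw [← ENNReal.ofReal_add h.nonneg_bound h.nonneg_lip]
          exact ENNReal.ofReal_le_ofReal hM

lemma exists_boundedLipschitz_of_mem_boundedKernels {R M : ℝ} (hR : 0 < R) (hM : 0 < M)
    {b : ℝ → ℝ} (h : b ∈ BoundedKernels M R) :
    ∃ S L, S + L ≤ M ∧ BoundedLipschitz (2 * R) S L b := by
  obtain ⟨hc, g, hw, hn⟩ := h
  exact hw.boundedLipschitz (by linarith) hc hM.le hn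

/-- Coercivity speaks of kernels on the whole half-line, whereas minimizers are controlled only on
`K`; this extension bridges the two. -/
lemma BoundedLipschitz.clampExtend_mem_admissible {r S L : ℝ} (hr : 0 < r) {b : ℝ → ℝ}
    (h : BoundedLipschitz r S L b) : clampExtend r b ∈ Admissible := by
  refine ⟨(h.lipschitzWith hr).continuous.continuousOn, ?_, deriv (clampExtend r b),
    hasWeakDerivOn_deriv_of_lipschitzWith (h.lipschitzWith hr) _, fun _ => ?_⟩
  · exact (supNormOn_le_ofReal measurableSet_Ici fun s _ => h.bound _ (clamp_mem hr s)).trans_lt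
      ENNReal.ofReal_lt_top
  · exact (supNormOn_deriv_clampExtend_le hr h measurableSet_Icc).trans_lt ENNReal.ofReal_lt_top

/-- Sequential compactness of `X_{M,K}` for uniform convergence on `K`. -/
lemma exists_subseq_tendstoUniformlyOn {R M : ℝ} (hR : 0 < R) (hM : 0 < M) {f : ℕ → ℝ → ℝ}
    (hf : ∀ n, f n ∈ BoundedKernels M R) :
    ∃ φ : ℕ → ℕ, StrictMono φ ∧ ∃ b ∈ BoundedKernels M R,
      TendstoUniformlyOn (fun k => f (φ k)) b atTop (Icc 0 (2 * R)) := by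
  have hr : 0 < 2 * R := by linarith
  choose S L hSL hB using fun n => exists_boundedLipschitz_of_mem_boundedKernels hR hM (hf n)
  have hmem : ∀ n, (S n, L n) ∈ Icc (0 : ℝ) M ×ˢ Icc (0 : ℝ) M := fun n =>
    ⟨⟨(hB n).nonneg_bound, by linarith [hSL n, (hB n).nonneg_lip]⟩,
      ⟨(hB n).nonneg_lip, by linarith [hSL n, (hB n).nonneg_bound]⟩⟩
  -- The two bounds are made to converge first: a uniform limit would otherwise inherit only `S ≤ M`
  -- and `L ≤ M`, not `S + L ≤ M`.
  obtain ⟨⟨S₀, L₀⟩, -, φ₁, hφ₁, hlim₁⟩ :=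
    (isCompact_Icc.prod isCompact_Icc).tendsto_subseq hmem
  let F : ℕ → BoundedContinuousFunction (Icc (0 : ℝ) (2 * R)) ℝ := fun n =>
    BoundedContinuousFunction.mkOfCompact ⟨fun s => f (φ₁ n) s, (hB (φ₁ n)).continuousOn.domRestrict⟩
  have hcomp : IsCompact (closure (range F)) := by
    refine BoundedContinuousFunction.arzela_ascoli (Icc (-M) M) isCompact_Icc _ ?_ ?_
    · rintro _ s ⟨n, rfl⟩
      have h1 := (hB (φ₁ n)).bound s s.2
      have h2 := (hmem (φ₁ n)).1.2
      exact abs_le.1 (h1.trans h2)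
    · refine (LipschitzWith.uniformEquicontinuous _ (⟨M, hM.le⟩ : ℝ≥0) ?_).equicontinuous
      rintro ⟨_, n, rfl⟩
      refine LipschitzWith.of_dist_le_mul fun s t => ?_
      exact ((hB (φ₁ n)).lip s s.2 t t.2).trans
        (mul_le_mul_of_nonneg_right (hmem (φ₁ n)).2.2 (abs_nonneg _))
  obtain ⟨G, -, φ₂, hφ₂, hlim₂⟩ := hcomp.tendsto_subseq (fun n => subset_closure (mem_range_self n))
  have hu := BoundedContinuousFunction.tendsto_iff_tendstoUniformly.1 hlim₂
  let b : ℝ → ℝ := IccExtend hr.le G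
  have hub : TendstoUniformlyOn (fun k => f (φ₁ (φ₂ k))) b atTop (Icc 0 (2 * R)) := by
    rw [tendstoUniformlyOn_iff_tendstoUniformly_comp_coe]
    have : b ∘ (fun s : Icc (0 : ℝ) (2 * R) => (s : ℝ)) = G := by
      ext s; simp [b, IccExtend_val]
    rw [this]
    exact hu
  refine ⟨φ₁ ∘ φ₂, hφ₁.comp hφ₂, b, ?_, hub⟩
  have hl := hlim₁.comp hφ₂.tendsto_atTop
  have hS : Tendsto (fun k => S (φ₁ (φ₂ k))) atTop (𝓝 S₀) := (continuous_fst.tendsto _).comp hl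
  have hL : Tendsto (fun k => L (φ₁ (φ₂ k))) atTop (𝓝 L₀) := (continuous_snd.tendsto _).comp hl
  have hb : BoundedLipschitz (2 * R) S₀ L₀ b := by
    refine ⟨ge_of_tendsto' hS fun k => (hB _).nonneg_bound,
      ge_of_tendsto' hL fun k => (hB _).nonneg_lip, fun s hs => ?_, fun s hs t ht => ?_⟩
    · exact le_of_tendsto_of_tendsto' (hub.tendsto_at hs).abs hS fun k => (hB _).bound s hs
    · exact le_of_tendsto_of_tendsto' ((hub.tendsto_at hs).sub (hub.tendsto_at ht)).abs
        (hL.mul_const _) fun k => (hB _).lip s hs t ht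
  exact hb.mem_boundedKernels hR (le_of_tendsto' (hS.add hL) fun k => hSL _)

/-! ### Lipschitz functions and the Kantorovich bound -/

section Duality

variable {E G : Type*} [NormedAddCommGroup E] [NormedAddCommGroup G]

/-- `f` is Lipschitz with the real constant `K ≥ 0`. -/
def IsLip (K : ℝ) (f : E → G) : Prop := 0 ≤ K ∧ ∀ x y, ‖f x - f y‖ ≤ K * ‖x - y‖

lemma IsLip.lipschitzWith {K : ℝ} {f : E → G} (h : IsLip K f) : LipschitzWith K.toNNReal f :=
  LipschitzWith.of_dist_le' fun x y => by simpa [dist_eq_norm] using h.2 x y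

lemma IsLip.continuous {K : ℝ} {f : E → G} (h : IsLip K f) : Continuous f :=
  h.lipschitzWith.continuous

lemma IsLip.neg {K : ℝ} {f : E → G} (h : IsLip K f) : IsLip K (fun x => - f x) :=
  ⟨h.1, fun x y => by
    have := h.2 y x
    rwa [norm_sub_rev y x, show f y - f x = -f x - -f y by abel] at this⟩

variable [MeasurableSpace E]

/-- A probability measure concentrated on the closed ball of radius `R` around the origin. -/
structure ProbOnBall (R : ℝ) (μ : Measure E) : Prop where
  prob : IsProbabilityMeasure μ
  ae_norm_le : ∀ᵐ x ∂μ, ‖x‖ ≤ R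

/-- Every `K`-Lipschitz function has integrals against `μ` and `ν` differing by at most `K δ`. -/
def KantorovichLE (μ ν : Measure E) (δ : ℝ) : Prop :=
  ∀ (K : ℝ) (f : E → ℝ), IsLip K f → ∫ x, f x ∂μ - ∫ x, f x ∂ν ≤ K * δ

lemma KantorovichLE.abs_sub_le {μ ν : Measure E} {δ : ℝ} (h : KantorovichLE μ ν δ) {K : ℝ} {f : E → ℝ}
    (hf : IsLip K f) : |∫ x, f x ∂μ - ∫ x, f x ∂ν| ≤ K * δ := by
  rw [abs_le]
  have h1 := h K f hf
  have h2 := h K _ hf.neg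
  rw [integral_neg, integral_neg] at h2
  constructor <;> linarith

lemma KantorovichLE.symm {μ ν : Measure E} {δ : ℝ} (h : KantorovichLE μ ν δ) :
    KantorovichLE ν μ δ := fun K f hf => by
  have := (abs_le.1 (h.abs_sub_le hf)).1
  linarith

lemma KantorovichLE.mono {μ ν : Measure E} {δ δ' : ℝ} (h : KantorovichLE μ ν δ) (hd : δ ≤ δ') :
    KantorovichLE μ ν δ' := fun K f hf =>
  (h K f hf).trans (mul_le_mul_of_nonneg_left hd hf.1)

lemma ProbOnBall.integrable_of_bound {R : ℝ} {μ : Measure E} (h : ProbOnBall R μ)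
    [NormedSpace ℝ G] {f : E → G} (hf : AEStronglyMeasurable f μ) (C : ℝ)
    (hC : ∀ x, ‖x‖ ≤ R → ‖f x‖ ≤ C) : Integrable f μ :=
  have := h.prob
  Integrable.of_bound hf C (h.ae_norm_le.mono fun x hx => hC x hx)

lemma ProbOnBall.integral_mono {R : ℝ} {μ : Measure E} (h : ProbOnBall R μ) {f g : E → ℝ}
    (hf : Integrable f μ) (hg : Integrable g μ) (hle : ∀ x, ‖x‖ ≤ R → f x ≤ g x) :
    ∫ x, f x ∂μ ≤ ∫ x, g x ∂μ :=
  integral_mono_ae hf hg (h.ae_norm_le.mono hle)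

lemma ProbOnBall.norm_integral_le {R : ℝ} {μ : Measure E} (h : ProbOnBall R μ) [NormedSpace ℝ G]
    {f : E → G} {C : ℝ} (hC : ∀ x, ‖x‖ ≤ R → ‖f x‖ ≤ C) : ‖∫ x, f x ∂μ‖ ≤ C := by
  have := h.prob
  have := norm_integral_le_of_norm_le_const (h.ae_norm_le.mono hC)
  simpa using this

lemma ProbOnBall.norm_integral_sub_le {R : ℝ} {μ : Measure E} (h : ProbOnBall R μ)
    [NormedSpace ℝ G] {f g : E → G} (hf : Integrable f μ) (hg : Integrable g μ) {C : ℝ}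
    (hC : ∀ x, ‖x‖ ≤ R → ‖f x - g x‖ ≤ C) : ‖∫ x, f x ∂μ - ∫ x, g x ∂μ‖ ≤ C := by
  rw [← integral_sub hf hg]
  exact h.norm_integral_le hC

/-- Both measures live on the ball, so `f` may be replaced by a Lipschitz extension from the ball
with the same constant. -/
lemma KantorovichLE.abs_sub_le_of_lipschitzOn {R : ℝ} {μ ν : Measure E} {δ : ℝ}
    (h : KantorovichLE μ ν δ) (hμ : ProbOnBall R μ) (hν : ProbOnBall R ν) {K : ℝ} (hK : 0 ≤ K)
    {f : E → ℝ} (hf : ∀ x y, ‖x‖ ≤ R → ‖y‖ ≤ R → |f x - f y| ≤ K * ‖x - y‖) :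
    |∫ x, f x ∂μ - ∫ x, f x ∂ν| ≤ K * δ := by
  have hL : LipschitzOnWith K.toNNReal f (Metric.closedBall 0 R) :=
    LipschitzOnWith.of_dist_le_mul fun x hx y hy => by
      rw [Real.coe_toNNReal _ hK, dist_eq_norm, dist_eq_norm]
      exact hf x y (by simpa using hx) (by simpa using hy)
  obtain ⟨g, hg, hfg⟩ := hL.extend_real
  have hg' : IsLip K g := ⟨hK, fun x y => by
    have := hg.dist_le_mul x y
    rwa [Real.coe_toNNReal _ hK, dist_eq_norm, dist_eq_norm] at this⟩
  have e : ∀ {ρ : Measure E}, ProbOnBall R ρ → ∫ x, f x ∂ρ = ∫ x, g x ∂ρ := fun hρ =>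
    integral_congr_ae (hρ.ae_norm_le.mono fun x hx => hfg (by simpa using hx))
  rw [e hμ, e hν]
  exact h.abs_sub_le hg'

variable [BorelSpace E] [NormedSpace ℝ E] [FiniteDimensional ℝ E]

lemma ProbOnBall.integrable [NormedSpace ℝ G] {R : ℝ} {μ : Measure E} (h : ProbOnBall R μ)
    {f : E → G} (hf : Continuous f) : Integrable f μ := by
  have := FiniteDimensional.proper_real E
  obtain ⟨C, hC⟩ := (isCompact_closedBall (0 : E) R).exists_bound_of_continuousOn hf.continuousOn
  exact h.integrable_of_bound hf.aestronglyMeasurable C fun x hx => hC x (by simpa using hx)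

lemma ProbOnBall.integrable_comp_sub [NormedSpace ℝ G] {R : ℝ} {μ : Measure E} (h : ProbOnBall R μ)
    {f : E → G} (hf : Continuous f) (x : E) : Integrable (fun y => f (x - y)) μ :=
  h.integrable (f := fun y => f (x - y)) (hf.comp (continuous_const.sub continuous_id))

end Duality

/-! ### First- and second-order bounds for test functions -/

section Differential

variable {E : Type*} [NormedAddCommGroup E] [NormedSpace ℝ E]

lemma norm_fderiv_le_of_isLip {K : ℝ} {f : E → ℝ} (hf : IsLip K f) (x : E) :
    ‖fderiv ℝ f x‖ ≤ K := by
  have := norm_fderiv_le_of_lipschitz ℝ hf.lipschitzWith (x₀ := x)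
  rwa [Real.coe_toNNReal _ hf.1] at this

/-- Second-order Taylor bound for a function with Lipschitz differential. -/
lemma abs_taylor_le {φ : E → ℝ} (hφ : Differentiable ℝ φ) {D : ℝ}
    (hD0 : 0 ≤ D) (hD : ∀ x y, ‖fderiv ℝ φ x - fderiv ℝ φ y‖ ≤ D * ‖x - y‖) (x v : E) :
    |φ (x + v) - φ x - fderiv ℝ φ x v| ≤ D * ‖v‖ ^ 2 := by
  have := (convex_closedBall x ‖v‖).norm_image_sub_le_of_norm_fderiv_le' (𝕜 := ℝ) (f := φ)
    (C := D * ‖v‖) (φ := fderiv ℝ φ x) (x := x) (y := x + v) (fun z _ => hφ z)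
    (fun z hz => (hD z x).trans (mul_le_mul_of_nonneg_left (by
      simpa [dist_eq_norm] using hz) hD0)) (by simp) (by simp)
  simp only [add_sub_cancel_left] at this
  rw [sq, ← mul_assoc]
  simpa using this

end Differential

/-! ### Vector-valued test functions and mollification -/

section Mollifier

variable {E : Type*} [NormedAddCommGroup E] [InnerProductSpace ℝ E] [FiniteDimensional ℝ E]
  [MeasurableSpace E] [BorelSpace E]

/-- Testing with the inner product against the difference `v` itself gives `‖v‖² ≤ ‖v‖ K δ`, hence
no dimensional constant. -/
lemma KantorovichLE.norm_integral_sub_le {R : ℝ} {μ ν : Measure E} {δ : ℝ}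
    (h : KantorovichLE μ ν δ) (hμ : ProbOnBall R μ) (hν : ProbOnBall R ν) {K : ℝ} {f : E → E}
    (hf : IsLip K f) (hδ : 0 ≤ δ) : ‖∫ x, f x ∂μ - ∫ x, f x ∂ν‖ ≤ K * δ := by
  set v := ∫ x, f x ∂μ - ∫ x, f x ∂ν with hv
  have hlip : IsLip (‖v‖ * K) (fun x => inner ℝ v (f x)) := by
    refine ⟨mul_nonneg (norm_nonneg _) hf.1, fun x y => ?_⟩
    rw [← inner_sub_right, mul_assoc]
    exact (norm_inner_le_norm _ _).trans (mul_le_mul_of_nonneg_left (hf.2 x y) (norm_nonneg _))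
  have h1 := h _ _ hlip
  rw [integral_inner (hμ.integrable hf.continuous), integral_inner (hν.integrable hf.continuous),
    ← inner_sub_right, ← hv, real_inner_self_eq_norm_sq] at h1
  rcases (norm_nonneg v).eq_or_lt with h0 | h0
  · rw [← h0]; exact mul_nonneg hf.1 hδ
  · have : ‖v‖ * ‖v‖ ≤ ‖v‖ * (K * δ) := by linarith [h1, sq ‖v‖]
    exact le_of_mul_le_mul_left this h0

/-- The average of `f (x - y)` over `y` distributed according to `m`. -/
noncomputable def mollify (m : Measure E) (f : E → ℝ) (x : E) : ℝ := ∫ y, f (x - y) ∂m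

lemma IsLip.mollify {m : Measure E} {ε K : ℝ} (hm : ProbOnBall ε m) {f : E → ℝ} (hf : IsLip K f) :
    IsLip K (mollify m f) :=
  ⟨hf.1, fun x y => hm.norm_integral_sub_le
    (hm.integrable_comp_sub hf.continuous x) (hm.integrable_comp_sub hf.continuous y)
    fun z _ => (hf.2 _ _).trans (by rw [sub_sub_sub_cancel_right])⟩

lemma IsLip.abs_mollify_sub_le {m : Measure E} {ε K : ℝ} (hm : ProbOnBall ε m) {f : E → ℝ}
    (hf : IsLip K f) (x : E) : |KernelLearning.mollify m f x - f x| ≤ K * ε := by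
  have := hm.prob
  have e : f x = ∫ _, f x ∂m := by simp
  rw [KernelLearning.mollify, e]
  refine hm.norm_integral_sub_le
    (hm.integrable_comp_sub hf.continuous x)
    (integrable_const _) fun z hz => (hf.2 _ _).trans ?_
  rw [show x - z - x = -z by abel, norm_neg]
  exact mul_le_mul_of_nonneg_left hz hf.1

/-- Mollifiers at scale `ε`: the average is smooth and its differential is Lipschitz, with a
constant proportional to that of the function. -/
lemma exists_mollifier (E : Type*) [NormedAddCommGroup E] [InnerProductSpace ℝ E]
    [FiniteDimensional ℝ E] [MeasurableSpace E] [BorelSpace E] {ε : ℝ} (hε : 0 < ε) :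
    ∃ m : Measure E, ProbOnBall ε m ∧ ∃ C : ℝ, 0 ≤ C ∧ ∀ (K : ℝ) (f : E → ℝ), IsLip K f →
      ContDiff ℝ (⊤ : ℕ∞) (mollify m f) ∧
      ∀ x y, ‖fderiv ℝ (mollify m f) x - fderiv ℝ (mollify m f) y‖ ≤ K * C * ‖x - y‖ := by
  let lam : Measure E := Measure.addHaar
  let η : ContDiffBump (0 : E) := ⟨ε / 2, ε, by positivity, by linarith⟩
  let w : E → ℝ := η.normed lam
  have hw0 : ∀ x, 0 ≤ w x := η.nonneg_normed
  have hwc : Continuous w := η.continuous_normed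
  have hwi : Integrable w lam := η.integrable_normed
  have hwk : HasCompactSupport w := η.hasCompactSupport_normed
  have hws : ContDiff ℝ (⊤ : ℕ∞) w := η.contDiff_normed
  have hdk : HasCompactSupport (fderiv ℝ w) := hwk.fderiv ℝ
  have hdc : Continuous (fderiv ℝ w) := hws.continuous_fderiv (by simp)
  have hdi : Integrable (fderiv ℝ w) lam := hdc.integrable_of_hasCompactSupport hdk
  let m : Measure E := lam.withDensity (fun x => ENNReal.ofReal (w x))
  have hmol : ∀ f : E → ℝ, mollify m f =
      MeasureTheory.convolution w f (ContinuousLinearMap.lsmul ℝ ℝ) lam := by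
    intro f
    ext x
    simp only [mollify, m]
    rw [integral_withDensity_eq_integral_toReal_smul
      (hwc.measurable.ennreal_ofReal) (by simp)]
    simp only [convolution_def, ContinuousLinearMap.lsmul_apply]
    congr 1 with y
    rw [ENNReal.toReal_ofReal (hw0 y)]
  refine ⟨m, ⟨⟨?_⟩, ?_⟩, ∫ y, ‖fderiv ℝ w y‖ ∂lam, integral_nonneg fun _ => norm_nonneg _, ?_⟩
  · simp only [m]
    rw [withDensity_apply _ MeasurableSet.univ, Measure.restrict_univ,
      ← ofReal_integral_eq_lintegral_ofReal hwi (Eventually.of_forall hw0),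
      η.integral_normed, ENNReal.ofReal_one]
  · rw [ae_withDensity_iff hwc.measurable.ennreal_ofReal]
    refine Eventually.of_forall fun x hx => ?_
    by_contra hn
    apply hx
    have : x ∉ Function.support w := by
      rw [η.support_normed_eq]
      intro hb
      rw [mem_ball_zero_iff] at hb
      exact hn hb.le
    rw [Function.notMem_support.1 this, ENNReal.ofReal_zero]
  · intro K f hf
    have hfl : LocallyIntegrable f lam := hf.continuous.locallyIntegrable
    rw [hmol]
    refine ⟨hwk.contDiff_convolution_left _ hws hfl, fun x y => ?_⟩
    -- The differential falls on the weight `w`, so differences of it involve `f` only through `f (x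
    -- - z) - f (y - z)`. This gives the constant `K ∫ ‖∇w‖` without any bound on `f`.
    have hfd : ∀ x, fderiv ℝ (MeasureTheory.convolution w f (ContinuousLinearMap.lsmul ℝ ℝ) lam) x
        = ∫ z, f (x - z) • fderiv ℝ w z ∂lam := by
      intro x
      rw [(hwk.hasFDerivAt_convolution_left (ContinuousLinearMap.lsmul ℝ ℝ)
        (hws.of_le (by simp)) hfl x).fderiv, convolution_def]
      congr 1 with z v
      simp [ContinuousLinearMap.precompL_apply, mul_comm]
    have hint : ∀ x, Integrable (fun z => f (x - z) • fderiv ℝ w z) lam := fun x =>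
      ((hf.continuous.comp (continuous_const.sub continuous_id)).smul
        hdc).integrable_of_hasCompactSupport hdk.smul_left
    rw [hfd, hfd, ← integral_sub (hint x) (hint y)]
    have : ∫ z, K * ‖x - y‖ * ‖fderiv ℝ w z‖ ∂lam = K * (∫ y, ‖fderiv ℝ w y‖ ∂lam) * ‖x - y‖ := by
      rw [integral_const_mul]; ring
    rw [← this]
    refine norm_integral_le_of_norm_le (hdi.norm.const_mul _) (Eventually.of_forall fun z => ?_)
    rw [← sub_smul, norm_smul]
    refine mul_le_mul_of_nonneg_right ((hf.2 _ _).trans ?_) (norm_nonneg _)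
    rw [sub_sub_sub_cancel_right]

end Mollifier

/-! ### Stability of measure-valued solutions with Lipschitz interaction -/

section Stability

/-- The mean value theorem replaces integration in time, so no integrability of `f'` is needed. -/
lemma abs_sub_sub_le_of_hasDerivAt {f f' : ℝ → ℝ} {a b c M : ℝ} (hab : a ≤ b)
    (hc : ContinuousOn f (Icc a b)) (hd : ∀ x ∈ Ioo a b, HasDerivAt f (f' x) x)
    (hM : ∀ x ∈ Ioo a b, |f' x - c| ≤ M) : |f b - f a - (b - a) * c| ≤ M * (b - a) := by
  rcases hab.eq_or_lt with rfl | hlt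
  · simp
  · obtain ⟨x, hx, he⟩ := exists_hasDerivAt_eq_slope f f' hlt hc hd
    have hpos : 0 < b - a := sub_pos.2 hlt
    have h1 : f b - f a = (b - a) * f' x := by rw [he]; field_simp
    rw [h1, ← mul_sub, abs_mul, abs_of_pos hpos, mul_comm]
    exact mul_le_mul_of_nonneg_right (hM x hx) hpos.le

variable {E : Type*} [NormedAddCommGroup E] [InnerProductSpace ℝ E] [MeasurableSpace E]

/-- The velocity field `F * μ`. -/
noncomputable def velocity (F : E → E) (μ : Measure E) (x : E) : E := ∫ y, F (x - y) ∂μ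

lemma norm_velocity_le {F : E → E} {B R : ℝ} (hB : ∀ z, ‖z‖ ≤ 2 * R → ‖F z‖ ≤ B) {μ : Measure E}
    (hμ : ProbOnBall R μ) {x : E} (hx : ‖x‖ ≤ R) : ‖velocity F μ x‖ ≤ B :=
  hμ.norm_integral_le fun y hy => hB _ (by linarith [norm_sub_le x y])

/-- A curve of probability measures on a ball solving `∂ₜμ = -∇·((F * μ) μ)` weakly on `[0, T]`. -/
structure WeakCurve (F : E → E) (T R : ℝ) (μ : ℝ → Measure E) : Prop where
  probOnBall : ∀ t ∈ Icc 0 T, ProbOnBall R (μ t)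
  continuousOn : ∀ φ : E → ℝ, ContDiff ℝ (⊤ : ℕ∞) φ →
    ContinuousOn (fun s => ∫ x, φ x ∂(μ s)) (Icc 0 T)
  hasDerivAt : ∀ φ : E → ℝ, ContDiff ℝ (⊤ : ℕ∞) φ → ∀ t ∈ Ioo 0 T,
    HasDerivAt (fun s => ∫ x, φ x ∂(μ s)) (∫ x, fderiv ℝ φ x (velocity F (μ t) x) ∂(μ t)) t

/-- A force field which is `L`-Lipschitz and bounded by `B` on the ball of radius `2R`. -/
structure ForceBound (F : E → E) (L B R : ℝ) : Prop where
  isLip : IsLip L F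
  nonneg : 0 ≤ B
  bound : ∀ z, ‖z‖ ≤ 2 * R → ‖F z‖ ≤ B

variable {F : E → E} {T R L B : ℝ} {μ ν : ℝ → Measure E}

/-- Mass moves with speed at most `B`, and `K` bounds the gradient of `φ`. -/
lemma WeakCurve.abs_integral_sub_le (h : WeakCurve F T R μ) (hF : ForceBound F L B R) {K : ℝ}
    {φ : E → ℝ} (hφ : ContDiff ℝ (⊤ : ℕ∞) φ) (hK : IsLip K φ) {s t : ℝ} (hs : 0 ≤ s) (hst : s ≤ t)
    (ht : t ≤ T) : |∫ x, φ x ∂(μ t) - ∫ x, φ x ∂(μ s)| ≤ K * (B * (t - s)) := by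
  have := abs_sub_sub_le_of_hasDerivAt (c := 0) (M := K * B) hst
    ((h.continuousOn φ hφ).mono (Icc_subset_Icc hs ht))
    (fun x hx => h.hasDerivAt φ hφ x ⟨hs.trans_lt hx.1, hx.2.trans_le ht⟩) (fun τ hτ => by
      rw [sub_zero, ← Real.norm_eq_abs]
      have hp := h.probOnBall τ ⟨hs.trans hτ.1.le, hτ.2.le.trans ht⟩
      refine hp.norm_integral_le fun x hx => ((fderiv ℝ φ x).le_opNorm _).trans ?_
      exact mul_le_mul (norm_fderiv_le_of_isLip hK x) (norm_velocity_le hF.bound hp hx)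
        (norm_nonneg _) hK.1)
  rw [mul_zero, sub_zero, mul_assoc] at this
  exact this

variable [FiniteDimensional ℝ E] [BorelSpace E]

lemma IsLip.velocity {F : E → E} {L R : ℝ} (hF : IsLip L F) {μ : Measure E} (hμ : ProbOnBall R μ) :
    IsLip L (velocity F μ) :=
  ⟨hF.1, fun x y => hμ.norm_integral_sub_le (hμ.integrable_comp_sub hF.continuous x)
    (hμ.integrable_comp_sub hF.continuous y)
    fun z _ => (hF.2 _ _).trans (by rw [sub_sub_sub_cancel_right])⟩

lemma IsLip.norm_velocity_sub_le {F : E → E} {L R δ : ℝ} (hF : IsLip L F) {μ ν : Measure E}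
    (hμ : ProbOnBall R μ) (hν : ProbOnBall R ν) (h : KantorovichLE μ ν δ) (hδ : 0 ≤ δ) (x : E) :
    ‖KernelLearning.velocity F μ x - KernelLearning.velocity F ν x‖ ≤ L * δ :=
  h.norm_integral_sub_le hμ hν (f := fun y => F (x - y))
    ⟨hF.1, fun y z => (hF.2 _ _).trans (by rw [sub_sub_sub_cancel_left, norm_sub_rev])⟩ hδ

/-- Mollification preserves the Lipschitz constant and changes each of the two integrals by at most
`K ε`, so the speed bound passes from smooth to all Lipschitz functions. -/
lemma WeakCurve.kantorovichLE (h : WeakCurve F T R μ) (hF : ForceBound F L B R) {s t : ℝ}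
    (hs : 0 ≤ s) (hst : s ≤ t) (ht : t ≤ T) : KantorovichLE (μ t) (μ s) (B * (t - s)) := by
  intro K f hf
  refine le_of_forall_pos_le_add fun e he => ?_
  obtain ⟨ε, hε, hεe⟩ : ∃ ε, 0 < ε ∧ 2 * K * ε ≤ e := by
    refine ⟨e / (2 * K + 1), by have := hf.1; positivity, ?_⟩
    have := hf.1
    rw [← mul_div_assoc, div_le_iff₀ (by positivity)]
    nlinarith
  obtain ⟨m, hm, C, -, hC⟩ := exists_mollifier E hε
  have h1 := h.abs_integral_sub_le hF (hC K f hf).1 (hf.mollify hm) hs hst ht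
  have hpt := h.probOnBall t ⟨hs.trans hst, ht⟩
  have hps := h.probOnBall s ⟨hs, hst.trans ht⟩
  have h2 := hpt.norm_integral_sub_le (hpt.integrable (hf.mollify hm).continuous)
    (hpt.integrable hf.continuous) fun x _ => hf.abs_mollify_sub_le hm x
  have h3 := hps.norm_integral_sub_le (hps.integrable (hf.mollify hm).continuous)
    (hps.integrable hf.continuous) fun x _ => hf.abs_mollify_sub_le hm x
  rw [Real.norm_eq_abs] at h2 h3
  rw [abs_le] at h1 h2 h3
  linarith [h1.2, h2.1, h3.2]

/-- One explicit Euler step reproduces the weak evolution up to second order. -/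
lemma WeakCurve.abs_integral_sub_euler_le (h : WeakCurve F T R μ) (hF : ForceBound F L B R)
    {K D : ℝ} {φ : E → ℝ} (hφ : ContDiff ℝ (⊤ : ℕ∞) φ) (hK : IsLip K φ) (hD0 : 0 ≤ D)
    (hD : ∀ x y, ‖fderiv ℝ φ x - fderiv ℝ φ y‖ ≤ D * ‖x - y‖) {s t : ℝ} (hs : 0 ≤ s)
    (hst : s ≤ t) (ht : t ≤ T) :
    |∫ x, φ x ∂(μ t) - ∫ x, φ (x + (t - s) • velocity F (μ s) x) ∂(μ s)|
      ≤ (2 * K * L * B + 2 * D * B ^ 2) * (t - s) ^ 2 := by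
  have hps := h.probOnBall s ⟨hs, hst.trans ht⟩
  have hL := hF.isLip.1
  have hB := hF.nonneg
  have hK0 := hK.1
  have hts : 0 ≤ t - s := sub_nonneg.2 hst
  set u := velocity F (μ s) with hu
  have hul : IsLip L u := hF.isLip.velocity hps
  have hub : ∀ x, ‖x‖ ≤ R → ‖u x‖ ≤ B := fun x hx => norm_velocity_le hF.bound hps hx
  have hφc : Continuous (fderiv ℝ φ) := hφ.continuous_fderiv (by simp)
  set c := ∫ x, fderiv ℝ φ x (u x) ∂(μ s) with hc
  have hcu : Continuous fun x => fderiv ℝ φ x (u x) := hφc.clm_apply hul.continuous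
  -- Since time `s` the measure has moved by at most `B (τ - s)`. `h1` pays for the resulting change
  -- of the velocity field, `h2` for the change of the measure of integration.
  have hderiv : ∀ τ ∈ Ioo s t, |∫ x, fderiv ℝ φ x (velocity F (μ τ) x) ∂(μ τ) - c|
      ≤ (2 * K * L * B + D * B ^ 2) * (t - s) := by
    intro τ hτ
    have hpτ := h.probOnBall τ ⟨hs.trans hτ.1.le, hτ.2.le.trans ht⟩
    have hk := h.kantorovichLE hF hs hτ.1.le (hτ.2.le.trans ht)
    have hτs : 0 ≤ τ - s := sub_nonneg.2 hτ.1.le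
    have hτt : τ - s ≤ t - s := by linarith [hτ.2]
    have hvl : IsLip L (velocity F (μ τ)) := hF.isLip.velocity hpτ
    have h1 : ‖∫ x, fderiv ℝ φ x (velocity F (μ τ) x) ∂(μ τ) - ∫ x, fderiv ℝ φ x (u x) ∂(μ τ)‖
        ≤ K * (L * (B * (τ - s))) :=
      hpτ.norm_integral_sub_le (hpτ.integrable (hφc.clm_apply hvl.continuous))
        (hpτ.integrable hcu) fun x _ => by
        rw [← map_sub]
        exact ((fderiv ℝ φ x).le_opNorm _).trans (mul_le_mul (norm_fderiv_le_of_isLip hK x)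
          (hF.isLip.norm_velocity_sub_le hpτ hps hk (by positivity) x) (norm_nonneg _) hK0)
    have h2 : |∫ x, fderiv ℝ φ x (u x) ∂(μ τ) - c| ≤ (K * L + D * B) * (B * (τ - s)) := by
      refine hk.abs_sub_le_of_lipschitzOn hpτ hps (by positivity) fun x y hx hy => ?_
      have e : fderiv ℝ φ x (u x) - fderiv ℝ φ y (u y)
          = fderiv ℝ φ x (u x - u y) + (fderiv ℝ φ x - fderiv ℝ φ y) (u y) := by
        simp
      rw [e]
      refine (abs_add_le _ _).trans ?_
      have i1 : |fderiv ℝ φ x (u x - u y)| ≤ K * (L * ‖x - y‖) :=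
        ((fderiv ℝ φ x).le_opNorm _).trans (mul_le_mul (norm_fderiv_le_of_isLip hK x)
          (hul.2 x y) (norm_nonneg _) hK0)
      have i2 : |(fderiv ℝ φ x - fderiv ℝ φ y) (u y)| ≤ D * ‖x - y‖ * B :=
        ((fderiv ℝ φ x - fderiv ℝ φ y).le_opNorm _).trans (mul_le_mul (hD x y)
          (hub y hy) (norm_nonneg _) (by positivity))
      linarith
    rw [Real.norm_eq_abs] at h1
    have h3 := abs_sub_le (∫ x, fderiv ℝ φ x (velocity F (μ τ) x) ∂(μ τ))
      (∫ x, fderiv ℝ φ x (u x) ∂(μ τ)) c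
    have h4 : (2 * K * L * B + D * B ^ 2) * (τ - s) ≤ (2 * K * L * B + D * B ^ 2) * (t - s) :=
      mul_le_mul_of_nonneg_left hτt (by positivity)
    linarith
  have hA := abs_sub_sub_le_of_hasDerivAt (c := c) hst
    ((h.continuousOn φ hφ).mono (Icc_subset_Icc hs ht))
    (fun x hx => h.hasDerivAt φ hφ x ⟨hs.trans_lt hx.1, hx.2.trans_le ht⟩) hderiv
  have hce : Continuous fun x => φ (x + (t - s) • u x) :=
    hφ.continuous.comp (continuous_id.add (continuous_const.smul hul.continuous))
  have hTay : |∫ x, φ (x + (t - s) • u x) ∂(μ s) - ∫ x, (φ x + (t - s) * fderiv ℝ φ x (u x)) ∂(μ s)|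
      ≤ D * B ^ 2 * (t - s) ^ 2 := by
    refine hps.norm_integral_sub_le (hps.integrable hce)
      (hps.integrable (hφ.continuous.add (continuous_const.mul hcu))) fun x hx => ?_
    have := abs_taylor_le (hφ.differentiable (by simp)) hD0 hD x ((t - s) • u x)
    rw [map_smul, smul_eq_mul, norm_smul, Real.norm_eq_abs, abs_of_nonneg hts] at this
    rw [Real.norm_eq_abs]
    refine (le_of_eq (congrArg abs (sub_sub _ _ _).symm)).trans (this.trans ?_)
    rw [mul_assoc, ← mul_pow]
    refine mul_le_mul_of_nonneg_left (pow_le_pow_left₀ (by positivity) ?_ 2) hD0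
    rw [mul_comm]
    exact mul_le_mul_of_nonneg_right (hub x hx) hts
  rw [integral_add (hps.integrable hφ.continuous) ((hps.integrable hcu).const_mul _),
    integral_const_mul, ← hc] at hTay
  rw [abs_le] at hA hTay ⊢
  constructor <;> nlinarith [hA.1, hA.2, hTay.1, hTay.2]

/-- One step of the discrete Gronwall argument, for mollified test functions. -/
lemma WeakCurve.mollified_step (hμ : WeakCurve F T R μ) (hν : WeakCurve F T R ν)
    (hF : ForceBound F L B R) {m : Measure E} {ε C : ℝ} (hε : 0 ≤ ε) (hm : ProbOnBall ε m)
    (hC0 : 0 ≤ C)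
    (hC : ∀ (K : ℝ) (f : E → ℝ), IsLip K f → ContDiff ℝ (⊤ : ℕ∞) (mollify m f) ∧
      ∀ x y, ‖fderiv ℝ (mollify m f) x - fderiv ℝ (mollify m f) y‖ ≤ K * C * ‖x - y‖)
    {s h δ : ℝ} (hs : 0 ≤ s) (hh : 0 ≤ h) (hT : s + h ≤ T) (hδ : 0 ≤ δ)
    (hstep : ∀ K f, IsLip K f →
      ∫ x, mollify m f x ∂(μ s) - ∫ x, mollify m f x ∂(ν s) ≤ K * δ) :
    ∀ K f, IsLip K f → ∫ x, mollify m f x ∂(μ (s + h)) - ∫ x, mollify m f x ∂(ν (s + h))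
      ≤ K * ((1 + 2 * h * L) * δ + (4 * h * L * ε + (4 * L * B + 4 * C * B ^ 2) * h ^ 2)) := by
  intro K f hf
  have hL := hF.isLip.1
  have hK := hf.1
  have hpμ := hμ.probOnBall s ⟨hs, by linarith⟩
  have hpν := hν.probOnBall s ⟨hs, by linarith⟩
  have hmf := hf.mollify hm
  set u := velocity F (μ s) with hu
  set v := velocity F (ν s) with hv
  have hul : IsLip L u := hF.isLip.velocity hpμ
  have hvl : IsLip L v := hF.isLip.velocity hpν
  -- Pulling `f` back by the Euler map of `μ` gives the test function to which the induction
  -- hypothesis is applied. Both curves use this same map; the discrepancy `u - v` is paid for in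
  -- `b3`.
  let g : E → ℝ := fun x => f (x + h • u x)
  have hg : IsLip (K * (1 + h * L)) g := by
    refine ⟨by positivity, fun x y => (hf.2 _ _).trans ?_⟩
    rw [mul_assoc]
    refine mul_le_mul_of_nonneg_left ?_ hK
    have e : x + h • u x - (y + h • u y) = (x - y) + h • (u x - u y) := by
      rw [smul_sub]; abel
    rw [e]
    refine (norm_add_le _ _).trans ?_
    rw [norm_smul, Real.norm_eq_abs, abs_of_nonneg hh]
    have := mul_le_mul_of_nonneg_left (hul.2 x y) hh
    linarith
  -- Commutator of mollification with the Euler step: shifting the argument by `y` with `‖y‖ ≤ ε`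
  -- changes the displacement `h • u` by at most `h L ε`.
  have hcomm : ∀ x, |mollify m f (x + h • u x) - mollify m g x| ≤ K * h * L * ε := by
    intro x
    refine hm.norm_integral_sub_le (hm.integrable_comp_sub hf.continuous _)
      (hm.integrable_comp_sub hg.continuous _) fun y hy => (hf.2 _ _).trans ?_
    have e : x + h • u x - y - (x - y + h • u (x - y)) = h • (u x - u (x - y)) := by
      rw [smul_sub]; abel
    rw [e, norm_smul, Real.norm_eq_abs, abs_of_nonneg hh]
    have h1 := hul.2 x (x - y)
    rw [sub_sub_cancel] at h1
    have h2 : L * ‖y‖ ≤ L * ε := mul_le_mul_of_nonneg_left hy hL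
    have := mul_le_mul_of_nonneg_left (h1.trans h2) (mul_nonneg hK hh)
    linarith
  have hdist : KantorovichLE (μ s) (ν s) (δ + 2 * ε) := by
    intro K' f' hf'
    have h1 := hstep K' f' hf'
    have h2 := hpμ.norm_integral_sub_le (hpμ.integrable (hf'.mollify hm).continuous)
      (hpμ.integrable hf'.continuous) fun x _ => hf'.abs_mollify_sub_le hm x
    have h3 := hpν.norm_integral_sub_le (hpν.integrable (hf'.mollify hm).continuous)
      (hpν.integrable hf'.continuous) fun x _ => hf'.abs_mollify_sub_le hm x
    rw [Real.norm_eq_abs] at h2 h3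
    rw [abs_le] at h2 h3
    linarith [h2.1, h3.2]
  have hcont : ∀ w : E → E, IsLip L w → Continuous fun x => mollify m f (x + h • w x) :=
    fun w hw => hmf.continuous.comp (continuous_id.add (continuous_const.smul hw.continuous))
  have a1 := hμ.abs_integral_sub_euler_le hF (hC K f hf).1 hmf (by positivity) (hC K f hf).2 hs
    (t := s + h) (by linarith) hT
  have a2 := hν.abs_integral_sub_euler_le hF (hC K f hf).1 hmf (by positivity) (hC K f hf).2 hs
    (t := s + h) (by linarith) hT
  rw [add_sub_cancel_left] at a1 a2
  have b1 := hpμ.norm_integral_sub_le (hpμ.integrable (hcont u hul))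
    (hpμ.integrable (hg.mollify hm).continuous) fun x _ => hcomm x
  have b2 := hpν.norm_integral_sub_le (hpν.integrable (hcont u hul))
    (hpν.integrable (hg.mollify hm).continuous) fun x _ => hcomm x
  have b3 := hpν.norm_integral_sub_le (C := K * (h * (L * (δ + 2 * ε))))
    (hpν.integrable (hcont u hul)) (hpν.integrable (hcont v hvl)) fun x _ => by
      refine (hmf.2 _ _).trans (mul_le_mul_of_nonneg_left ?_ hK)
      rw [add_sub_add_left_eq_sub, ← smul_sub, norm_smul, Real.norm_eq_abs, abs_of_nonneg hh]
      exact mul_le_mul_of_nonneg_left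
        (hF.isLip.norm_velocity_sub_le hpμ hpν hdist (by positivity) x) hh
  have c1 := hstep _ g hg
  rw [Real.norm_eq_abs] at b1 b2 b3
  rw [abs_le] at a1 a2 b1 b2 b3
  -- In `2 h L δ`, one half is the stretching of the test function (`c1`), the other the dependence
  -- of the field on the measure (`b3`). The commutators contribute `2 h L ε` and `b3` another `2 h
  -- L ε`; the `h²` term is twice the Euler error with `D = K C`.
  linarith [a1.2, a2.1, b1.2, b2.1, b3.1]

lemma geometric_step_le {x y : ℝ} (hx : 0 ≤ x) (hy : 0 ≤ y) {δ : ℝ} (k : ℕ) :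
    (1 + x) * ((1 + x) ^ k * (δ + k * y)) + y ≤ (1 + x) ^ (k + 1) * (δ + (k + 1 : ℕ) * y) := by
  have h1 : 1 ≤ (1 + x) ^ (k + 1) := one_le_pow₀ (by linarith)
  have h2 : y ≤ (1 + x) ^ (k + 1) * y := le_mul_of_one_le_left hy h1
  push_cast
  rw [pow_succ] at *
  nlinarith

/-- Stability of weak solutions with respect to the initial condition. -/
theorem WeakCurve.stability (hμ : WeakCurve F T R μ) (hν : WeakCurve F T R ν)
    (hF : ForceBound F L B R) {δ : ℝ} (hδ : 0 ≤ δ) (h0 : KantorovichLE (μ 0) (ν 0) δ) {t : ℝ}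
    (ht : t ∈ Icc 0 T) : KantorovichLE (μ t) (ν t) (Real.exp (2 * L * T) * δ) := by
  have hL := hF.isLip.1
  have hB := hF.nonneg
  have ht0 := ht.1
  have hp0 : (0 : ℝ) ∈ Icc 0 T := ⟨le_rfl, ht.1.trans ht.2⟩
  have hpμ := hμ.probOnBall t ht
  have hpν := hν.probOnBall t ht
  have hfix : ∀ ε : ℝ, 0 < ε → ∀ K f, IsLip K f → ∫ x, f x ∂(μ t) - ∫ x, f x ∂(ν t)
      ≤ K * (Real.exp (2 * L * t) * (δ + 4 * L * ε * t) + 2 * ε) := by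
    intro ε hε K f hf
    obtain ⟨m, hm, C, hC0, hC⟩ := exists_mollifier E hε
    -- `C`, and hence `A`, depends on the scale `ε`. The number of steps must therefore tend to
    -- infinity before `ε` tends to zero.
    set A := 4 * L * B + 4 * C * B ^ 2 with hA
    have hA0 : 0 ≤ A := by positivity
    have hn : ∀ n : ℕ, 0 < n → ∫ x, mollify m f x ∂(μ t) - ∫ x, mollify m f x ∂(ν t)
        ≤ K * (Real.exp (2 * L * t) * (δ + (4 * L * ε * t + A * t * (t / n)))) := by
      intro n hn
      have hn' : (0 : ℝ) < n := by exact_mod_cast hn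
      set h := t / n with hh
      have hh0 : 0 ≤ h := by positivity
      have hnh : n * h = t := by rw [hh]; field_simp
      set y := 4 * h * L * ε + A * h ^ 2 with hy
      have hy0 : 0 ≤ y := by positivity
      have ind : ∀ k : ℕ, k ≤ n → ∀ K f, IsLip K f →
          ∫ x, mollify m f x ∂(μ (k * h)) - ∫ x, mollify m f x ∂(ν (k * h))
            ≤ K * ((1 + 2 * h * L) ^ k * (δ + k * y)) := by
        intro k
        induction k with
        | zero =>
          intro _ K f hf
          simpa using h0 K _ (hf.mollify hm)
        | succ k ih =>
          intro hk K f hf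
          have hkT : k * h + h ≤ T := by
            have : ((k + 1 : ℕ) : ℝ) * h ≤ n * h :=
              mul_le_mul_of_nonneg_right (by exact_mod_cast hk) hh0
            rw [hnh] at this
            push_cast at this
            linarith [ht.2]
          have := hμ.mollified_step hν hF hε.le hm hC0 hC (by positivity) hh0 hkT (by positivity)
            (ih (by omega)) K f hf
          have e : ((k + 1 : ℕ) : ℝ) * h = k * h + h := by push_cast; ring
          rw [e]
          refine this.trans (mul_le_mul_of_nonneg_left ?_ hf.1)
          exact geometric_step_le (by positivity) hy0 k
      have := ind n le_rfl K f hf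
      rw [hnh] at this
      refine this.trans (mul_le_mul_of_nonneg_left ?_ hf.1)
      have e1 : (1 + 2 * h * L) ^ n ≤ Real.exp (2 * L * t) := by
        have : 1 + 2 * h * L ≤ Real.exp (2 * h * L) := by
          linarith [Real.add_one_le_exp (2 * h * L)]
        refine (pow_le_pow_left₀ (by positivity) this n).trans ?_
        rw [← Real.exp_nat_mul]
        refine (congrArg Real.exp ?_).le
        rw [← hnh]; ring
      have e2 : n * y = 4 * L * ε * t + A * t * h := by
        rw [hy, ← hnh]; ring
      rw [e2]
      exact mul_le_mul_of_nonneg_right e1 (by positivity)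
    have hlim : Tendsto (fun n : ℕ =>
        K * (Real.exp (2 * L * t) * (δ + (4 * L * ε * t + A * t * (t / n))))) atTop
        (𝓝 (K * (Real.exp (2 * L * t) * (δ + (4 * L * ε * t + A * t * 0))))) :=
      (((((tendsto_const_div_atTop_nhds_zero_nat t).const_mul _).const_add _).const_add
        _).const_mul _).const_mul _
    have hle := ge_of_tendsto hlim (eventually_atTop.2 ⟨1, fun n h => hn n h⟩)
    have h2 := hpμ.norm_integral_sub_le (hpμ.integrable (hf.mollify hm).continuous)
      (hpμ.integrable hf.continuous) fun x _ => hf.abs_mollify_sub_le hm x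
    have h3 := hpν.norm_integral_sub_le (hpν.integrable (hf.mollify hm).continuous)
      (hpν.integrable hf.continuous) fun x _ => hf.abs_mollify_sub_le hm x
    rw [Real.norm_eq_abs] at h2 h3
    rw [abs_le] at h2 h3
    rw [mul_zero, add_zero] at hle
    linarith [h2.1, h3.2]
  intro K f hf
  have hlim : Tendsto (fun ε : ℝ => K * (Real.exp (2 * L * t) * (δ + 4 * L * ε * t) + 2 * ε))
      (𝓝[>] 0) (𝓝 (K * (Real.exp (2 * L * t) * (δ + 4 * L * 0 * t) + 2 * 0))) := by
    have : Continuous fun ε : ℝ =>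
        K * (Real.exp (2 * L * t) * (δ + 4 * L * ε * t) + 2 * ε) := by fun_prop
    exact (this.tendsto 0).mono_left nhdsWithin_le_nhds
  have hle := ge_of_tendsto hlim (eventually_mem_nhdsWithin.mono fun ε hε => hfix ε hε K f hf)
  refine hle.trans (mul_le_mul_of_nonneg_left ?_ hf.1)
  simp only [mul_zero, zero_mul, add_zero]
  refine mul_le_mul_of_nonneg_right (Real.exp_le_exp.2 ?_) hδ
  exact mul_le_mul_of_nonneg_left ht.2 (by positivity)

end Stability

/-! ### The interaction force, the mean-field curve and the empirical curve -/

section Curves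

variable {d : ℕ}

/-- Easy half of Kantorovich duality: every coupling writes the difference of integrals as `∫ (f p.1
- f p.2) dπ`. The case `K = 0` is separate because the proof divides by `K`. -/
lemma enorm_integral_sub_le_W₁ {R : ℝ} {μ ν : Measure (EuclideanSpace ℝ (Fin d))}
    (hμ : ProbOnBall R μ) (hν : ProbOnBall R ν) {K : ℝ} {f : EuclideanSpace ℝ (Fin d) → ℝ}
    (hf : IsLip K f) : ‖∫ x, f x ∂μ - ∫ x, f x ∂ν‖ₑ ≤ ENNReal.ofReal K * W₁ μ ν := by
  have := hμ.prob
  have := hν.prob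
  rcases hf.1.eq_or_lt with rfl | hK
  · have hc : f = fun _ => f 0 := by
      ext x
      have := hf.2 x 0
      rw [zero_mul] at this
      exact sub_eq_zero.1 (norm_le_zero_iff.1 this)
    rw [hc]
    simp
  have hK0 : ENNReal.ofReal K ≠ 0 := by simpa using hK
  rw [← ENNReal.div_le_iff' hK0 ENNReal.ofReal_ne_top, W₁]
  refine le_iInf₂ fun π hπ => ?_
  rw [ENNReal.div_le_iff' hK0 ENNReal.ofReal_ne_top]
  have hm1 : AEMeasurable Prod.fst π := measurable_fst.aemeasurable
  have hm2 : AEMeasurable Prod.snd π := measurable_snd.aemeasurable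
  have i1 : Integrable (fun p => f p.1) π := by
    have := hμ.integrable hf.continuous
    rw [← hπ.1] at this
    exact this.comp_measurable measurable_fst
  have i2 : Integrable (fun p => f p.2) π := by
    have := hν.integrable hf.continuous
    rw [← hπ.2] at this
    exact this.comp_measurable measurable_snd
  have e1 : ∫ x, f x ∂μ = ∫ p, f p.1 ∂π := by
    rw [← hπ.1, Measure.fst, integral_map hm1 hf.continuous.aestronglyMeasurable]
  have e2 : ∫ x, f x ∂ν = ∫ p, f p.2 ∂π := by
    rw [← hπ.2, Measure.snd, integral_map hm2 hf.continuous.aestronglyMeasurable]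
  rw [e1, e2, ← integral_sub i1 i2, ← lintegral_const_mul' _ _ ENNReal.ofReal_ne_top]
  refine (enorm_integral_le_lintegral_enorm _).trans (lintegral_mono fun p => ?_)
  rw [edist_dist, ← ENNReal.ofReal_mul hf.1, dist_eq_norm, ← ofReal_norm]
  exact ENNReal.ofReal_le_ofReal (hf.2 _ _)

lemma KantorovichLE.of_W₁_le {R δ : ℝ} {μ ν : Measure (EuclideanSpace ℝ (Fin d))}
    (hμ : ProbOnBall R μ) (hν : ProbOnBall R ν) (hδ : 0 ≤ δ) (h : W₁ μ ν ≤ ENNReal.ofReal δ) :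
    KantorovichLE μ ν δ := by
  intro K f hf
  have h1 := (enorm_integral_sub_le_W₁ hμ hν hf).trans (mul_le_mul_right h _)
  rw [← ENNReal.ofReal_mul hf.1, ← ofReal_norm,
    ENNReal.ofReal_le_ofReal_iff (mul_nonneg hf.1 hδ)] at h1
  exact (le_abs_self _).trans h1

lemma force_clampExtend {r : ℝ} (b : ℝ → ℝ) {z : EuclideanSpace ℝ (Fin d)} (hz : ‖z‖ ≤ r) :
    force (clampExtend r b) z = force b z := by
  simp only [force]
  rw [← clampExtend_eqOn b ⟨norm_nonneg z, hz⟩]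

/-- With `‖y‖ ≤ ‖x‖`, the kernel difference is made to multiply the shorter vector `y`. If `‖y‖ ≤ r`
this costs `r L`; otherwise both kernel values lie in the constant range and the difference
vanishes. -/
lemma BoundedLipschitz.isLip_force {r S L : ℝ} (hr : 0 < r) {b : ℝ → ℝ}
    (h : BoundedLipschitz r S L b) :
    IsLip (S + r * L) (force (d := d) (clampExtend r b)) := by
  have hS := h.nonneg_bound
  have hL := h.nonneg_lip
  have hbd : ∀ s, |clampExtend r b s| ≤ S := fun s => h.bound _ (clamp_mem hr s)
  have key : ∀ x y : EuclideanSpace ℝ (Fin d), ‖y‖ ≤ ‖x‖ →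
      ‖force (clampExtend r b) x - force (clampExtend r b) y‖ ≤ (S + r * L) * ‖x - y‖ := by
    intro x y hxy
    have e : force (clampExtend r b) x - force (clampExtend r b) y
        = -(clampExtend r b ‖x‖ • (x - y)
          + (clampExtend r b ‖x‖ - clampExtend r b ‖y‖) • y) := by
      simp only [force, smul_sub, sub_smul]; abel
    rw [e, norm_neg]
    refine (norm_add_le _ _).trans ?_
    rw [norm_smul, norm_smul, add_mul]
    refine add_le_add (mul_le_mul_of_nonneg_right (hbd _) (norm_nonneg _)) ?_
    rcases le_or_gt ‖y‖ r with hy | hy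
    · have h1 : |clampExtend r b ‖x‖ - clampExtend r b ‖y‖| ≤ L * ‖x - y‖ :=
        ((h.lipschitzWith hr).dist_le_mul ‖x‖ ‖y‖).trans
          (mul_le_mul_of_nonneg_left (abs_norm_sub_norm_le x y) hL)
      have := mul_le_mul h1 hy (norm_nonneg _) (mul_nonneg hL (norm_nonneg _))
      rw [Real.norm_eq_abs]
      linarith
    · have : clampExtend r b ‖x‖ = clampExtend r b ‖y‖ := by
        simp only [clampExtend]
        rw [min_eq_right hy.le, min_eq_right (hy.le.trans hxy)]
      rw [this, sub_self, norm_zero, zero_mul]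
      positivity
  refine ⟨by positivity, fun x y => ?_⟩
  rcases le_total ‖y‖ ‖x‖ with hxy | hxy
  · exact key x y hxy
  · rw [norm_sub_rev, norm_sub_rev x y]
    exact key y x hxy

lemma BoundedLipschitz.norm_force_le {r S L : ℝ} {b : ℝ → ℝ}
    (h : BoundedLipschitz r S L b) {z : EuclideanSpace ℝ (Fin d)} (hz : ‖z‖ ≤ r) :
    ‖force (clampExtend r b) z‖ ≤ S * r := by
  rw [force_clampExtend b hz, force, norm_neg, norm_smul]
  exact mul_le_mul (h.bound _ ⟨norm_nonneg _, hz⟩) hz (norm_nonneg _) h.nonneg_bound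

lemma BoundedLipschitz.forceBound {R S L : ℝ} (hR : 0 < R) {b : ℝ → ℝ}
    (h : BoundedLipschitz (2 * R) S L b) :
    ForceBound (force (d := d) (clampExtend (2 * R) b)) (S + 2 * R * L) (S * (2 * R)) R :=
  ⟨h.isLip_force (by positivity), mul_nonneg h.nonneg_bound (by positivity),
    fun _ hz => h.norm_force_le hz⟩

lemma conv_eq_velocity {R : ℝ} {μ : Measure (EuclideanSpace ℝ (Fin d))} (hμ : ProbOnBall R μ)
    {F G : EuclideanSpace ℝ (Fin d) → EuclideanSpace ℝ (Fin d)}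
    (h : ∀ z, ‖z‖ ≤ 2 * R → F z = G z) {x : EuclideanSpace ℝ (Fin d)} (hx : ‖x‖ ≤ R) :
    conv F μ x = velocity G μ x :=
  integral_congr_ae (hμ.ae_norm_le.mono fun y hy => h _ (by linarith [norm_sub_le x y]))

lemma ProbOnBall.of_support_subset {R : ℝ} {μ : Measure (EuclideanSpace ℝ (Fin d))}
    [IsProbabilityMeasure μ] (h : μ.support ⊆ Metric.closedBall 0 R) : ProbOnBall R μ := by
  refine ⟨inferInstance, ?_⟩
  have : μ.support ∈ ae μ := Measure.support_mem_ae_of_regular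
  filter_upwards [this] with x hx
  simpa using h hx

lemma exists_isLip_of_hasCompactSupport {φ : EuclideanSpace ℝ (Fin d) → ℝ}
    (h : ContDiff ℝ (⊤ : ℕ∞) φ) (hc : HasCompactSupport φ) : ∃ K, IsLip K φ := by
  obtain ⟨D, hD⟩ := ContDiff.lipschitzWith_of_hasCompactSupport hc h (by simp)
  exact ⟨D, D.2, fun x y => by simpa [dist_eq_norm] using hD.dist_le_mul x y⟩

lemma IsMeanFieldSolution.weakCurve {a : ℝ → ℝ} {T R : ℝ}
    {μ₀ : Measure (EuclideanSpace ℝ (Fin d))} {μ : ℝ → Measure (EuclideanSpace ℝ (Fin d))}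
    (hμ : IsMeanFieldSolution a T μ₀ μ) (hR : IsConfiningRadius a T μ₀ R) :
    WeakCurve (force (clampExtend (2 * R) a)) T R μ := by
  have hp : ∀ t ∈ Icc 0 T, ProbOnBall R (μ t) := fun t ht => by
    have := hμ.isProbabilityMeasure t ht
    exact ProbOnBall.of_support_subset (hR.meanField μ hμ t ht)
  have hR0 := hR.pos
  -- The cutoff equals one near the ball carrying the measures. It removes the compact support
  -- condition on test functions, which mollified Lipschitz functions need not satisfy.
  let χ : ContDiffBump (0 : EuclideanSpace ℝ (Fin d)) :=
    ⟨R + 1, R + 2, by positivity, by linarith⟩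
  have hχ : ∀ φ : EuclideanSpace ℝ (Fin d) → ℝ, ∀ x, ‖x‖ ≤ R →
      (fun y => χ y * φ y) =ᶠ[𝓝 x] φ := fun φ x hx => by
    have : Metric.ball (0 : EuclideanSpace ℝ (Fin d)) (R + 1) ∈ 𝓝 x :=
      Metric.isOpen_ball.mem_nhds (by rw [mem_ball_zero_iff]; linarith)
    filter_upwards [this] with y hy
    rw [χ.one_of_mem_closedBall (Metric.ball_subset_closedBall hy), one_mul]
  have hsm : ∀ φ : EuclideanSpace ℝ (Fin d) → ℝ, ContDiff ℝ (⊤ : ℕ∞) φ →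
      ContDiff ℝ (⊤ : ℕ∞) fun y => χ y * φ y := fun φ hφ => χ.contDiff.mul hφ
  have hcs : ∀ φ : EuclideanSpace ℝ (Fin d) → ℝ, HasCompactSupport fun y => χ y * φ y :=
    fun φ => χ.hasCompactSupport.mul_right
  have hint : ∀ φ : EuclideanSpace ℝ (Fin d) → ℝ, ∀ t ∈ Icc 0 T,
      ∫ x, φ x ∂(μ t) = ∫ x, χ x * φ x ∂(μ t) := fun φ t ht =>
    integral_congr_ae ((hp t ht).ae_norm_le.mono fun x hx => (hχ φ x hx).self_of_nhds.symm)
  refine ⟨hp, fun φ hφ => ?_, fun φ hφ t ht => ?_⟩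
  · refine ContinuousOn.congr (f := fun s => ∫ x, χ x * φ x ∂(μ s)) (fun t ht => ?_) (hint φ)
    obtain ⟨K, hK⟩ := exists_isLip_of_hasCompactSupport (hsm φ hφ) (hcs φ)
    rw [ContinuousWithinAt, tendsto_iff_edist_tendsto_0]
    have h0 := ENNReal.Tendsto.const_mul (a := ENNReal.ofReal K) (hμ.continuous t ht)
      (Or.inr ENNReal.ofReal_ne_top)
    rw [mul_zero] at h0
    refine tendsto_of_tendsto_of_tendsto_of_le_of_le' tendsto_const_nhds h0
      (Eventually.of_forall fun _ => zero_le) ?_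
    filter_upwards [self_mem_nhdsWithin] with s hs
    rw [edist_eq_enorm_sub]
    exact enorm_integral_sub_le_W₁ (hp s hs) (hp t ht) hK
  · have htc := Ioo_subset_Icc_self ht
    have h1 := (hμ.weak _ (hsm φ hφ) (hcs φ) t (Ioo_subset_Ioc_self ht)).hasDerivAt
      (Icc_mem_nhds ht.1 ht.2)
    have e : ∫ x, fderiv ℝ (fun y => χ y * φ y) x (conv (force a) (μ t) x) ∂(μ t)
        = ∫ x, fderiv ℝ φ x (velocity (force (clampExtend (2 * R) a)) (μ t) x) ∂(μ t) := by
      refine integral_congr_ae ((hp t htc).ae_norm_le.mono fun x hx => ?_)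
      simp only
      rw [(hχ φ x hx).fderiv_eq, conv_eq_velocity (hp t htc)
        (fun z hz => (force_clampExtend a hz).symm) hx]
    rw [e] at h1
    refine h1.congr_of_eventuallyEq ?_
    filter_upwards [Icc_mem_nhds ht.1 ht.2] with s hs
    exact hint φ s hs

variable {N : ℕ}

lemma integral_empiricalMeasure {G : Type*} [NormedAddCommGroup G] [NormedSpace ℝ G]
    [CompleteSpace G] (x : Fin N → EuclideanSpace ℝ (Fin d))
    (f : EuclideanSpace ℝ (Fin d) → G) :
    ∫ y, f y ∂(empiricalMeasure x) = (N : ℝ)⁻¹ • ∑ i, f (x i) := by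
  rw [empiricalMeasure, integral_smul_measure, integral_finsetSum_measure]
  · simp
  · intro i _
    exact integrable_dirac (by simp)

lemma lintegral_empiricalMeasure (x : Fin N → EuclideanSpace ℝ (Fin d))
    (f : EuclideanSpace ℝ (Fin d) → ℝ≥0∞) :
    ∫⁻ y, f y ∂(empiricalMeasure x) = (N : ℝ≥0∞)⁻¹ * ∑ i, f (x i) := by
  rw [empiricalMeasure, lintegral_smul_measure, lintegral_finsetSum_measure]
  simp

lemma probOnBall_empiricalMeasure {R : ℝ} (hN : 1 ≤ N) {x : Fin N → EuclideanSpace ℝ (Fin d)}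
    (hx : ∀ i, ‖x i‖ ≤ R) : ProbOnBall R (empiricalMeasure x) := by
  refine ⟨⟨?_⟩, ?_⟩
  · have := lintegral_empiricalMeasure x (fun _ => 1)
    rw [lintegral_one] at this
    rw [this]
    simp only [Finset.sum_const, Finset.card_univ, Fintype.card_fin, nsmul_eq_mul, mul_one]
    exact ENNReal.inv_mul_cancel (by simp; omega) (by simp)
  · rw [empiricalMeasure]
    refine Measure.ae_smul_measure ?_ _
    rw [ae_finsetSum_measure_iff]
    intro i _
    rw [ae_dirac_eq]
    exact hx i

lemma IsParticleSolution.weakCurve {a : ℝ → ℝ} {T R : ℝ} (hN : 1 ≤ N)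
    {x₀ : Fin N → EuclideanSpace ℝ (Fin d)} {x : Fin N → ℝ → EuclideanSpace ℝ (Fin d)}
    (hx : IsParticleSolution a T x₀ x) (hb : ∀ i, ∀ t ∈ Icc 0 T, ‖x i t‖ ≤ R) :
    WeakCurve (force (clampExtend (2 * R) a)) T R (fun t => empiricalMeasure fun i => x i t) := by
  have hp : ∀ t ∈ Icc 0 T, ProbOnBall R (empiricalMeasure fun i => x i t) := fun t ht =>
    probOnBall_empiricalMeasure hN fun i => hb i t ht
  refine ⟨hp, fun φ hφ => ?_, fun φ hφ t ht => ?_⟩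
  · simp_rw [integral_empiricalMeasure]
    refine ContinuousOn.const_smul (continuousOn_finsetSum _ fun i _ => ?_) (N : ℝ)⁻¹
    exact hφ.continuous.comp_continuousOn fun t ht => (hx.2 i t ht).continuousWithinAt
  · have htc := Ioo_subset_Icc_self ht
    simp_rw [integral_empiricalMeasure]
    refine HasDerivAt.fun_const_smul (N : ℝ)⁻¹ (HasDerivAt.fun_sum fun i _ => ?_)
    rw [← conv_eq_velocity (hp t htc) (fun z hz => (force_clampExtend a hz).symm) (hb i t htc),
      conv, integral_empiricalMeasure]
    have h1 := (hx.2 i t htc).hasDerivAt (Icc_mem_nhds ht.1 ht.2)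
    exact ((hφ.differentiable (by simp)) (x i t)).hasFDerivAt.comp_hasDerivAt t h1

lemma discreteErrorFunctional_eq (a : ℝ → ℝ) (T : ℝ) (x : Fin N → ℝ → EuclideanSpace ℝ (Fin d))
    (b : ℝ → ℝ) : discreteErrorFunctional a T x b
      = errorFunctional a T (fun t => empiricalMeasure fun i => x i t) b := by
  simp only [discreteErrorFunctional, errorFunctional, lintegral_empiricalMeasure, conv,
    integral_empiricalMeasure]

end Curves

/-! ### Estimates for the error functionals -/

section ErrorFunctional

variable {d : ℕ}

lemma IsLip.sub {E G : Type*} [NormedAddCommGroup E] [NormedAddCommGroup G] {K K' : ℝ}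
    {f g : E → G} (hf : IsLip K f) (hg : IsLip K' g) : IsLip (K + K') fun x => f x - g x :=
  ⟨add_nonneg hf.1 hg.1, fun x y => by
    rw [sub_sub_sub_comm, add_mul]
    exact (norm_sub_le _ _).trans (add_le_add (hf.2 x y) (hg.2 x y))⟩

lemma ForceBound.sub {E : Type*} [NormedAddCommGroup E] {F G : E → E}
    {L B L' B' R : ℝ} (hF : ForceBound F L B R) (hG : ForceBound G L' B' R) :
    ForceBound (fun z => F z - G z) (L + L') (B + B') R :=
  ⟨hF.isLip.sub hG.isLip, add_nonneg hF.nonneg hG.nonneg, fun z hz =>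
    (norm_sub_le _ _).trans (add_le_add (hF.bound z hz) (hG.bound z hz))⟩

lemma abs_sq_norm_sub_sq_norm_le {E : Type*} [NormedAddCommGroup E] {v w : E} {B δ : ℝ} (hv : ‖v‖ ≤ B) (hw : ‖w‖ ≤ B)
    (h : ‖v - w‖ ≤ δ) : |‖v‖ ^ 2 - ‖w‖ ^ 2| ≤ 2 * B * δ := by
  have e : ‖v‖ ^ 2 - ‖w‖ ^ 2 = (‖v‖ + ‖w‖) * (‖v‖ - ‖w‖) := by ring
  rw [e, abs_mul, abs_of_nonneg (by positivity)]
  exact mul_le_mul (by linarith) ((abs_norm_sub_norm_le v w).trans h) (abs_nonneg _)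
    (by linarith [norm_nonneg v])

section Generic

variable {E : Type*} [NormedAddCommGroup E] [InnerProductSpace ℝ E] [FiniteDimensional ℝ E]
  [MeasurableSpace E] [BorelSpace E]

lemma ProbOnBall.integrable_norm_sq {R : ℝ} {μ : Measure E} (hμ : ProbOnBall R μ) {u : E → E}
    (hu : Continuous u) : Integrable (fun x => ‖u x‖ ^ 2) μ :=
  hμ.integrable (hu.norm.pow 2)

lemma ProbOnBall.lintegral_enorm_sq {R : ℝ} {μ : Measure E} (hμ : ProbOnBall R μ) {u : E → E}
    (hu : Continuous u) : ∫⁻ x, ‖u x‖ₑ ^ 2 ∂μ = ENNReal.ofReal (∫ x, ‖u x‖ ^ 2 ∂μ) := by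
  rw [ofReal_integral_eq_lintegral_ofReal (f := fun x => ‖u x‖ ^ 2)
    (hμ.integrable_norm_sq hu)
    (Eventually.of_forall fun x => by positivity)]
  congr 1 with x
  rw [ENNReal.ofReal_pow (norm_nonneg _), ofReal_norm]

/-- The field is changed first and the measure of integration second; each change costs `2 B L δ`,
since squares of vectors bounded by `B` differ by at most `2 B` times the distance. -/
lemma ForceBound.lintegral_velocity_le {F : E → E} {L B R δ : ℝ} (hF : ForceBound F L B R)
    {μ ν : Measure E} (hμ : ProbOnBall R μ) (hν : ProbOnBall R ν) (h : KantorovichLE μ ν δ)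
    (hδ : 0 ≤ δ) : ∫⁻ x, ‖velocity F μ x‖ₑ ^ 2 ∂μ
      ≤ ∫⁻ x, ‖velocity F ν x‖ₑ ^ 2 ∂ν + ENNReal.ofReal (4 * B * L * δ) := by
  have hB := hF.nonneg
  have hL := hF.isLip.1
  have hv := hF.isLip.velocity hμ
  have hw := hF.isLip.velocity hν
  rw [hμ.lintegral_enorm_sq hv.continuous, hν.lintegral_enorm_sq hw.continuous,
    ← ENNReal.ofReal_add (integral_nonneg fun _ => by positivity) (by positivity)]
  refine ENNReal.ofReal_le_ofReal ?_
  have h1 : ‖∫ x, ‖velocity F μ x‖ ^ 2 ∂μ - ∫ x, ‖velocity F ν x‖ ^ 2 ∂μ‖ ≤ 2 * B * (L * δ) :=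
    hμ.norm_integral_sub_le (hμ.integrable_norm_sq hv.continuous)
      (hμ.integrable_norm_sq hw.continuous) fun x hx =>
      abs_sq_norm_sub_sq_norm_le (norm_velocity_le hF.bound hμ hx)
        (norm_velocity_le hF.bound hν hx) (hF.isLip.norm_velocity_sub_le hμ hν h hδ x)
  have h2 : |∫ x, ‖velocity F ν x‖ ^ 2 ∂μ - ∫ x, ‖velocity F ν x‖ ^ 2 ∂ν| ≤ 2 * B * L * δ := by
    refine h.abs_sub_le_of_lipschitzOn hμ hν (by positivity) fun x y hx hy => ?_
    rw [mul_assoc]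
    exact abs_sq_norm_sub_sq_norm_le (norm_velocity_le hF.bound hν hx)
      (norm_velocity_le hF.bound hν hy) (hw.2 x y)
  rw [Real.norm_eq_abs] at h1
  linarith [(abs_le.1 h1).2, (abs_le.1 h2).2]

end Generic

/-- The factor is finite and the added term constant, so no measurability in `t` of the integrands
is required. -/
lemma ofReal_inv_mul_lintegral_add_const_le {T : ℝ} (hT : 0 < T) {f g : ℝ → ℝ≥0∞} {C k : ℝ≥0∞}
    (hk : k ≠ ∞) (h : ∀ t ∈ Icc 0 T, f t ≤ k * g t + C) :
    (ENNReal.ofReal T)⁻¹ * ∫⁻ t in Icc 0 T, f t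
      ≤ k * ((ENNReal.ofReal T)⁻¹ * ∫⁻ t in Icc 0 T, g t) + C := by
  have h1 : ∫⁻ t in Icc 0 T, f t ≤ k * (∫⁻ t in Icc 0 T, g t) + C * ENNReal.ofReal T := by
    calc ∫⁻ t in Icc 0 T, f t ≤ ∫⁻ t in Icc 0 T, (k * g t + C) :=
          setLIntegral_mono' measurableSet_Icc h
      _ = _ := by
          rw [lintegral_add_right _ measurable_const, lintegral_const_mul' _ _ hk,
            setLIntegral_const, Real.volume_Icc, sub_zero]
  refine (mul_le_mul_right h1 _).trans (le_of_eq ?_)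
  rw [mul_add, mul_left_comm, mul_left_comm _ C, ENNReal.inv_mul_cancel (by simpa using hT)
    ENNReal.ofReal_ne_top, mul_one]

variable {a b : ℝ → ℝ} {T R S L S' L' : ℝ} {μ ν : ℝ → Measure (EuclideanSpace ℝ (Fin d))}

lemma force_sub_eq (a b : ℝ → ℝ) (z : EuclideanSpace ℝ (Fin d)) (hz : ‖z‖ ≤ 2 * R) :
    force b z - force a z
      = force (clampExtend (2 * R) b) z - force (clampExtend (2 * R) a) z := by
  rw [force_clampExtend b hz, force_clampExtend a hz]

lemma lintegral_conv_eq (a b : ℝ → ℝ) {m : Measure (EuclideanSpace ℝ (Fin d))}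
    (hm : ProbOnBall R m) : ∫⁻ x, ‖conv (fun z => force b z - force a z) m x‖ₑ ^ 2 ∂m
      = ∫⁻ x, ‖velocity (fun z => force (clampExtend (2 * R) b) z
        - force (clampExtend (2 * R) a) z) m x‖ₑ ^ 2 ∂m :=
  lintegral_congr_ae (hm.ae_norm_le.mono fun x hx => by
    simp only
    rw [conv_eq_velocity hm (force_sub_eq a b) hx])

/-- The error functionals of two curves at Kantorovich distance `δ` differ by `O(δ)`, uniformly in
the kernel. -/
lemma errorFunctional_le_add (hT : 0 < T) (hR : 0 < R) {M δ : ℝ}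
    (ha : BoundedLipschitz (2 * R) S L a) (haM : S + L ≤ M)
    (hb : BoundedLipschitz (2 * R) S' L' b) (hbM : S' + L' ≤ M)
    (hμ : ∀ t ∈ Icc 0 T, ProbOnBall R (μ t)) (hν : ∀ t ∈ Icc 0 T, ProbOnBall R (ν t))
    (hδ : 0 ≤ δ) (h : ∀ t ∈ Icc 0 T, KantorovichLE (μ t) (ν t) δ) :
    errorFunctional a T μ b ≤ errorFunctional a T ν b
      + ENNReal.ofReal (4 * (M * (2 * R) + M * (2 * R)) * (2 * (M + 2 * R * M)) * δ) := by
  -- On the relevant ball each force is bounded by `M * (2 * R)`, and it is Lipschitz with constant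
  -- `M + 2 * R * M`; the constant in the statement is `4 B L` for their difference.
  have hF := (hb.forceBound (d := d) hR).sub (ha.forceBound hR)
  have e := ofReal_inv_mul_lintegral_add_const_le hT (k := 1) ENNReal.one_ne_top
    (f := fun t => ∫⁻ x, ‖conv (fun z => force b z - force a z) (μ t) x‖ₑ ^ 2 ∂(μ t))
    (g := fun t => ∫⁻ x, ‖conv (fun z => force b z - force a z) (ν t) x‖ₑ ^ 2 ∂(ν t))
    (C := ENNReal.ofReal (4 * (M * (2 * R) + M * (2 * R)) * (2 * (M + 2 * R * M)) * δ))
    fun t ht => by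
      rw [lintegral_conv_eq a b (hμ t ht), lintegral_conv_eq a b (hν t ht), one_mul]
      refine (hF.lintegral_velocity_le (hμ t ht) (hν t ht) (h t ht) hδ).trans ?_
      refine add_le_add le_rfl (ENNReal.ofReal_le_ofReal ?_)
      have h1 := ha.nonneg_bound
      have h2 := ha.nonneg_lip
      have h3 := hb.nonneg_bound
      have h4 := hb.nonneg_lip
      have l1 : L ≤ M := by linarith
      have l2 : L' ≤ M := by linarith
      have s1 : S ≤ M := by linarith
      have s2 : S' ≤ M := by linarith
      have m0 : 0 ≤ M := by linarith
      rw [two_mul (M + 2 * R * M)]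
      gcongr
  rw [one_mul] at e
  exact e

lemma two_mul_ofReal (r : ℝ) : 2 * ENNReal.ofReal r = ENNReal.ofReal (2 * r) := by
  rw [ENNReal.ofReal_mul (by norm_num), ENNReal.ofReal_ofNat]

/-- Dependence of the error functional on the kernel. -/
lemma errorFunctional_le_two_mul_add (hT : 0 < T) (hR : 0 < R) {b₁ : ℝ → ℝ} {S₁ L₁ ε : ℝ}
    (ha : BoundedLipschitz (2 * R) S L a) (hb : BoundedLipschitz (2 * R) S' L' b)
    (hb₁ : BoundedLipschitz (2 * R) S₁ L₁ b₁)
    (hμ : ∀ t ∈ Icc 0 T, ProbOnBall R (μ t))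
    (hε : ∀ s ∈ Icc 0 (2 * R), |b s - b₁ s| ≤ ε) :
    errorFunctional a T μ b
      ≤ 2 * errorFunctional a T μ b₁ + ENNReal.ofReal (2 * (2 * R * ε) ^ 2) := by
  have hε0 : 0 ≤ ε := (abs_nonneg _).trans (hε 0 ⟨le_rfl, by positivity⟩)
  have hF := (hb.forceBound (d := d) hR).sub (ha.forceBound hR)
  have hF₁ := (hb₁.forceBound (d := d) hR).sub (ha.forceBound hR)
  refine ofReal_inv_mul_lintegral_add_const_le hT ENNReal.ofNat_ne_top fun t ht => ?_
  have hp := hμ t ht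
  have hv := (hF.isLip.velocity hp).continuous
  have hv₁ := (hF₁.isLip.velocity hp).continuous
  rw [lintegral_conv_eq a b hp, lintegral_conv_eq a b₁ hp, hp.lintegral_enorm_sq hv,
    hp.lintegral_enorm_sq hv₁, two_mul_ofReal,
    ← ENNReal.ofReal_add (mul_nonneg (by norm_num) (integral_nonneg fun _ => by positivity))
      (by positivity)]
  refine ENNReal.ofReal_le_ofReal ?_
  have := hp.prob
  have e : 2 * (∫ x, ‖velocity (fun z => force (clampExtend (2 * R) b₁) z
        - force (clampExtend (2 * R) a) z) (μ t) x‖ ^ 2 ∂(μ t)) + 2 * (2 * R * ε) ^ 2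
      = ∫ x, (2 * ‖velocity (fun z => force (clampExtend (2 * R) b₁) z
        - force (clampExtend (2 * R) a) z) (μ t) x‖ ^ 2 + 2 * (2 * R * ε) ^ 2) ∂(μ t) := by
    rw [integral_add ((hp.integrable_norm_sq hv₁).const_mul 2) (integrable_const _),
      integral_const_mul]
    simp
  rw [e]
  refine hp.integral_mono (hp.integrable_norm_sq hv)
    (((hp.integrable_norm_sq hv₁).const_mul 2).add (integrable_const _)) fun x hx => ?_
  -- A force is a kernel value times a vector of length at most `2R`. The factor two in the
  -- statement then comes from `(p + q)² ≤ 2 p² + 2 q²`.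
  have hd : ‖velocity (fun z => force (clampExtend (2 * R) b) z
        - force (clampExtend (2 * R) a) z) (μ t) x - velocity (fun z =>
        force (clampExtend (2 * R) b₁) z - force (clampExtend (2 * R) a) z) (μ t) x‖
        ≤ 2 * R * ε := by
    refine hp.norm_integral_sub_le (hp.integrable_comp_sub hF.isLip.continuous x)
      (hp.integrable_comp_sub hF₁.isLip.continuous x) fun y hy => ?_
    have hz : ‖x - y‖ ≤ 2 * R := by linarith [norm_sub_le x y]
    rw [sub_sub_sub_cancel_right, force_clampExtend b hz, force_clampExtend b₁ hz, force, force,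
      neg_sub_neg, ← sub_smul, norm_smul, norm_sub_rev, mul_comm]
    exact mul_le_mul hz (hε _ ⟨norm_nonneg _, hz⟩) (norm_nonneg _) (by positivity)
  set p := velocity (fun z => force (clampExtend (2 * R) b) z
        - force (clampExtend (2 * R) a) z) (μ t) x
  set q := velocity (fun z => force (clampExtend (2 * R) b₁) z
        - force (clampExtend (2 * R) a) z) (μ t) x
  have h1 : ‖p‖ ≤ ‖q‖ + 2 * R * ε := by
    have := norm_add_le q (p - q)
    rw [add_sub_cancel] at this
    linarith
  have h2 := pow_le_pow_left₀ (norm_nonneg p) h1 2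
  nlinarith [sq_nonneg (‖q‖ - 2 * R * ε)]

lemma errorFunctional_self (a : ℝ → ℝ) (T : ℝ) (μ : ℝ → Measure (EuclideanSpace ℝ (Fin d))) :
    errorFunctional a T μ a = 0 := by
  simp [errorFunctional, conv]

lemma errorFunctional_clampExtend (hμ : ∀ t ∈ Icc 0 T, ProbOnBall R (μ t)) :
    errorFunctional a T μ b = errorFunctional a T μ (clampExtend (2 * R) b) := by
  unfold errorFunctional
  congr 1
  refine setLIntegral_congr_fun measurableSet_Icc fun t ht => ?_
  refine lintegral_congr_ae ((hμ t ht).ae_norm_le.mono fun x hx => ?_)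
  simp only
  rw [conv_eq_velocity (hμ t ht) (G := fun z => force (clampExtend (2 * R) b) z - force a z)
    (fun z hz => by rw [force_clampExtend b hz]) hx]
  rfl

/-! ### The measure `ρ` -/

lemma averagedDistanceLaw_compl_Icc (hμ : ∀ t ∈ Icc 0 T, ProbOnBall R (μ t)) :
    averagedDistanceLaw T μ (Icc 0 (2 * R))ᶜ = 0 := by
  rw [averagedDistanceLaw, Measure.smul_apply, smul_eq_mul]
  refine mul_eq_zero_of_right _ ?_
  -- If the curve of laws is not measurable, `Measure.bind` takes its default value zero and the
  -- claim is trivial.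
  by_cases hm : AEMeasurable (distanceLaw μ) (volume.restrict (Icc 0 T))
  · rw [Measure.bind_apply measurableSet_Icc.compl hm]
    refine setLIntegral_eq_zero measurableSet_Icc fun t ht => ?_
    have := (hμ t ht).prob
    rw [distanceLaw, Measure.map_apply (by fun_prop) measurableSet_Icc.compl]
    change ∀ᵐ p ∂((μ t).prod (μ t)), dist p.1 p.2 ∈ Icc 0 (2 * R)
    have h1 : ∀ᵐ p ∂((μ t).prod (μ t)), ‖p.1‖ ≤ R :=
      Measure.quasiMeasurePreserving_fst.ae (hμ t ht).ae_norm_le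
    have h2 : ∀ᵐ p ∂((μ t).prod (μ t)), ‖p.2‖ ≤ R :=
      Measure.quasiMeasurePreserving_snd.ae (hμ t ht).ae_norm_le
    filter_upwards [h1, h2] with p hp1 hp2
    refine ⟨dist_nonneg, ?_⟩
    rw [dist_eq_norm]
    linarith [norm_sub_le p.1 p.2]
  · rw [Measure.bind, Measure.map_of_not_aemeasurable hm, Measure.join_zero]
    simp

lemma averagedDistanceLaw_univ_le (hT : 0 < T) (hμ : ∀ t ∈ Icc 0 T, ProbOnBall R (μ t)) :
    averagedDistanceLaw T μ univ ≤ 1 := by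
  rw [averagedDistanceLaw, Measure.smul_apply, smul_eq_mul]
  by_cases hm : AEMeasurable (distanceLaw μ) (volume.restrict (Icc 0 T))
  · rw [Measure.bind_apply MeasurableSet.univ hm]
    have : ∫⁻ t in Icc 0 T, distanceLaw μ t univ = ENNReal.ofReal T := by
      rw [setLIntegral_congr_fun measurableSet_Icc (g := fun _ => 1) fun t ht => ?_]
      · simp
      · have := (hμ t ht).prob
        simp only [distanceLaw]
        rw [Measure.map_apply (by fun_prop) MeasurableSet.univ]
        simp
    rw [this, ENNReal.inv_mul_cancel (by simpa using hT) ENNReal.ofReal_ne_top]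
  · rw [Measure.bind, Measure.map_of_not_aemeasurable hm, Measure.join_zero]
    simp

lemma rho_ae_mem_Icc (hμ : ∀ t ∈ Icc 0 T, ProbOnBall R (μ t)) :
    ∀ᵐ s ∂(rho T μ), s ∈ Icc 0 (2 * R) :=
  withDensity_absolutelyContinuous _ _ (averagedDistanceLaw_compl_Icc hμ)

lemma isFiniteMeasure_rho (hT : 0 < T) (hμ : ∀ t ∈ Icc 0 T, ProbOnBall R (μ t)) :
    IsFiniteMeasure (rho T μ) := by
  refine ⟨?_⟩
  rw [rho, withDensity_apply _ MeasurableSet.univ, Measure.restrict_univ]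
  have h : ∀ᵐ s ∂(averagedDistanceLaw T μ), s ∈ Icc 0 (2 * R) := averagedDistanceLaw_compl_Icc hμ
  calc _ ≤ ∫⁻ _, ENNReal.ofReal ((2 * R) ^ 2) ∂(averagedDistanceLaw T μ) :=
        lintegral_mono_ae (h.mono fun s hs =>
          ENNReal.ofReal_le_ofReal (pow_le_pow_left₀ hs.1 hs.2 2))
    _ < ∞ := by
        rw [lintegral_const]
        exact ENNReal.mul_lt_top ENNReal.ofReal_lt_top
          ((averagedDistanceLaw_univ_le hT hμ).trans_lt ENNReal.one_lt_top)

/-- Coercivity tested with the extension of a kernel given on `[0, 2R]`. -/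
lemma Coercive.mul_eLpNorm_sq_le {c : ℝ} (hc : Coercive a T μ c) (hT : 0 < T) (hR : 0 < R)
    (hμ : ∀ t ∈ Icc 0 T, ProbOnBall R (μ t)) (hb : BoundedLipschitz (2 * R) S L b) :
    ENNReal.ofReal c * eLpNorm (fun s => a s - b s) 2 (rho T μ) ^ 2
      ≤ errorFunctional a T μ b := by
  have hr : 0 < 2 * R := by positivity
  have := isFiniteMeasure_rho hT hμ
  have hmem : MemLp (clampExtend (2 * R) b) 2 (rho T μ) :=
    MemLp.of_bound (hb.lipschitzWith hr).continuous.aestronglyMeasurable S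
      (Eventually.of_forall fun s => hb.bound _ (clamp_mem hr s))
  have h := hc _ (hb.clampExtend_mem_admissible hr) hmem
  rw [← errorFunctional_clampExtend hμ] at h
  have e : eLpNorm (fun s => a s - b s) 2 (rho T μ)
      = eLpNorm (fun s => clampExtend (2 * R) b s - a s) 2 (rho T μ) := by
    refine eLpNorm_congr_norm_ae ((rho_ae_mem_Icc hμ).mono fun s hs => ?_)
    rw [← clampExtend_eqOn b hs, norm_sub_rev]
  rw [e]
  exact h

end ErrorFunctional

/-! ### Convergence of the empirical measures of independent samples -/

section Sampling

/-- Independence holds only within each row, and the samples for different `N` may depend on each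
other arbitrarily, so a strong law for one sequence does not apply. Hoeffding's inequality gives the
bound `exp (-2 ε² N)`, which is summable, and Borel–Cantelli concludes without independence between
rows. -/
lemma ae_eventually_sum_lt {E : Type*} [MeasurableSpace E] {μ₀ : Measure E} {Ω : Type*}
    [MeasurableSpace Ω] {P : Measure Ω} [IsProbabilityMeasure P]
    {X : (N : ℕ) → Fin N → Ω → E} (hlaw : ∀ N i, HasLaw (X N i) μ₀ P)
    (hindep : ∀ N, iIndepFun (X N) P) {f : E → ℝ} (hf : Measurable f) {u : ℝ}
    (hfu : ∀ x, f x ∈ Icc u (u + 1)) {ε : ℝ} (hε : 0 < ε) :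
    ∀ᵐ ω ∂P, ∀ᶠ N : ℕ in atTop, ∑ i, (f (X N i ω) - ∫ x, f x ∂μ₀) < ε * N := by
  have hbound : ∀ N : ℕ, P {ω | ε * N ≤ ∑ i, (f (X N i ω) - ∫ x, f x ∂μ₀)}
      ≤ ENNReal.ofReal (Real.exp (-(2 * ε ^ 2)) ^ N) := by
    intro N
    have hE : ∀ i, ∫ ω, f (X N i ω) ∂P = ∫ x, f x ∂μ₀ := fun i =>
      (hlaw N i).integral_comp hf.aestronglyMeasurable
    have hsub : ∀ i ∈ (Finset.univ : Finset (Fin N)), HasSubgaussianMGF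
        (fun ω => f (X N i ω) - ∫ x, f x ∂μ₀) ((‖u + 1 - u‖₊ / 2) ^ 2) P := by
      intro i _
      rw [← hE i]
      exact hasSubgaussianMGF_of_mem_Icc (hf.comp_aemeasurable (hlaw N i).aemeasurable)
        (Eventually.of_forall fun ω => hfu _)
    have hind : iIndepFun (fun i ω => f (X N i ω) - ∫ x, f x ∂μ₀) P :=
      (hindep N).comp (fun _ x => f x - ∫ x, f x ∂μ₀) fun _ => hf.sub_const _
    have h := HasSubgaussianMGF.measure_sum_ge_le_of_iIndepFun hind hsub
      (ε := ε * N) (by positivity)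
    rw [← ofReal_measureReal]
    refine ENNReal.ofReal_le_ofReal (h.trans (le_of_eq ?_))
    rw [← Real.exp_nat_mul]
    congr 1
    rcases Nat.eq_zero_or_pos N with rfl | hN
    · simp
    · have : (N : ℝ) ≠ 0 := by positivity
      simp
      field_simp
  have hsum : ∑' N : ℕ, P {ω | ε * N ≤ ∑ i, (f (X N i ω) - ∫ x, f x ∂μ₀)} ≠ ∞ := by
    refine ne_top_of_le_ne_top ?_ (ENNReal.tsum_le_tsum hbound)
    refine (Summable.tsum_ofReal_ne_top (summable_geometric_of_lt_one (Real.exp_pos _).le ?_))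
    rw [Real.exp_lt_one_iff]
    nlinarith [sq_pos_of_pos hε]
  have := measure_setOfPred_frequently_eq_zero hsum
  rw [← compl_mem_ae_iff] at this
  filter_upwards [this] with ω hω
  simpa [not_frequently] using hω

variable {d : ℕ} {μ₀ : Measure (EuclideanSpace ℝ (Fin d))} {Ω : Type*}
  [MeasurableSpace Ω] {P : Measure Ω} [IsProbabilityMeasure P]
  {X : (N : ℕ) → Fin N → Ω → EuclideanSpace ℝ (Fin d)}

/-- The one-sided estimate is applied to `f` and to `-f`, with the countably many tolerances `1 / (k
+ 1)`. -/
lemma ae_tendsto_integral_indicator [IsProbabilityMeasure μ₀]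
    (hlaw : ∀ N i, HasLaw (X N i) μ₀ P)
    (hindep : ∀ N, iIndepFun (X N) P) {A : Set (EuclideanSpace ℝ (Fin d))} (hA : MeasurableSet A) :
    ∀ᵐ ω ∂P, Tendsto (fun N : ℕ => ∫ x, A.indicator (fun _ => (1 : ℝ)) x
      ∂(empiricalMeasure fun i => X N i ω)) atTop
      (𝓝 (∫ x, A.indicator (fun _ => (1 : ℝ)) x ∂μ₀)) := by
  set f : EuclideanSpace ℝ (Fin d) → ℝ := A.indicator fun _ => 1 with hf
  have hfm : Measurable f := measurable_const.indicator hA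
  have hf01 : ∀ x, 0 ≤ f x ∧ f x ≤ 1 := fun x => by
    by_cases hx : x ∈ A <;> simp [hf, hx]
  have h1 : ∀ᵐ ω ∂P, ∀ k : ℕ, ∀ᶠ N : ℕ in atTop,
      ∑ i, (f (X N i ω) - ∫ x, f x ∂μ₀) < 1 / ((k : ℝ) + 1) * N :=
    ae_all_iff.2 fun k => ae_eventually_sum_lt hlaw hindep hfm (u := 0)
      (fun x => by simpa using hf01 x) (by positivity)
  have h2 : ∀ᵐ ω ∂P, ∀ k : ℕ, ∀ᶠ N : ℕ in atTop,
      ∑ i, (-f (X N i ω) - ∫ x, -f x ∂μ₀) < 1 / ((k : ℝ) + 1) * N :=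
    ae_all_iff.2 fun k => ae_eventually_sum_lt hlaw hindep hfm.neg (u := -1)
      (fun x => ⟨by simpa using (hf01 x).2, by simpa using (hf01 x).1⟩) (by positivity)
  filter_upwards [h1, h2] with ω hω1 hω2
  rw [Metric.tendsto_atTop']
  intro ε hε
  obtain ⟨k, hk⟩ := exists_nat_one_div_lt hε
  obtain ⟨N₀, hN₀⟩ := eventually_atTop.1 ((hω1 k).and (hω2 k))
  refine ⟨N₀, fun N hN => ?_⟩
  obtain ⟨b1, b2⟩ := hN₀ N hN.le
  have hNpos : (0 : ℝ) < N := by exact_mod_cast (Nat.zero_le _).trans_lt hN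
  rw [integral_neg] at b2
  simp only [Finset.sum_sub_distrib, Finset.sum_neg_distrib, Finset.sum_const, Finset.card_univ,
    Fintype.card_fin, nsmul_eq_mul] at b1 b2
  rw [integral_empiricalMeasure, smul_eq_mul, Real.dist_eq]
  have e : (N : ℝ)⁻¹ * ∑ i, f (X N i ω) - ∫ x, f x ∂μ₀
      = (N : ℝ)⁻¹ * (∑ i, f (X N i ω) - N * ∫ x, f x ∂μ₀) := by field_simp
  refine lt_trans ?_ hk
  rw [e, abs_mul, abs_of_pos (inv_pos.2 hNpos), inv_mul_lt_iff₀ hNpos, abs_lt]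
  constructor <;> linarith

lemma exists_simpleFunc_near (R : ℝ) {η : ℝ} (hη : 0 < η) :
    ∃ s : SimpleFunc (EuclideanSpace ℝ (Fin d)) (EuclideanSpace ℝ (Fin d)),
      ∀ x, ‖x‖ ≤ R → ‖s x - x‖ ≤ η := by
  let e := TopologicalSpace.denseSeq (EuclideanSpace ℝ (Fin d))
  obtain ⟨t, ht⟩ := (isCompact_closedBall (0 : EuclideanSpace ℝ (Fin d)) R).elim_finite_subcover
    (fun k => Metric.ball (e k) η) (fun _ => Metric.isOpen_ball) (fun x _ => by
      obtain ⟨k, hk⟩ := (TopologicalSpace.denseRange_denseSeq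
        (EuclideanSpace ℝ (Fin d))).exists_dist_lt x hη
      exact mem_iUnion.2 ⟨k, hk⟩)
  refine ⟨SimpleFunc.nearestPt e (t.sup id), fun x hx => ?_⟩
  have hx' : x ∈ Metric.closedBall (0 : EuclideanSpace ℝ (Fin d)) R := by simpa using hx
  obtain ⟨k, hk, hxk⟩ := mem_iUnion₂.1 (ht hx')
  have h1 := SimpleFunc.edist_nearestPt_le e x (Finset.le_sup (f := id) hk)
  rw [edist_dist, edist_dist, ENNReal.ofReal_le_ofReal_iff dist_nonneg] at h1
  rw [← dist_eq_norm]
  rw [Metric.mem_ball'] at hxk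
  exact h1.trans hxk.le

/-- The cells of `s` are small, so the integral of any Lipschitz function is determined up to `K η`
by finitely many cell masses. -/
lemma ProbOnBall.abs_integral_sub_sum_le {R η K : ℝ} {μ : Measure (EuclideanSpace ℝ (Fin d))}
    (hμ : ProbOnBall R μ)
    (s : SimpleFunc (EuclideanSpace ℝ (Fin d)) (EuclideanSpace ℝ (Fin d)))
    (hs : ∀ x, ‖x‖ ≤ R → ‖s x - x‖ ≤ η) {f : EuclideanSpace ℝ (Fin d) → ℝ} (hf : IsLip K f) :
    |∫ x, f x ∂μ - ∑ y ∈ s.range, f y * ∫ x, (s ⁻¹' {y}).indicator (fun _ => (1 : ℝ)) x ∂μ|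
      ≤ K * η := by
  have := hμ.prob
  have hi : ∀ y ∈ s.range, Integrable
      (fun x => f y * (s ⁻¹' {y}).indicator (fun _ => (1 : ℝ)) x) μ := fun y _ =>
    ((integrable_const (1 : ℝ)).indicator (s.measurableSet_preimage {y})).const_mul _
  simp_rw [← integral_const_mul]
  rw [← integral_finsetSum _ hi]
  refine hμ.norm_integral_sub_le (hμ.integrable hf.continuous) (integrable_finsetSum _ hi)
    fun x hx => ?_
  have e : ∑ y ∈ s.range, f y * (s ⁻¹' {y}).indicator (fun _ => (1 : ℝ)) x = f (s x) := by
    rw [Finset.sum_eq_single (s x)]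
    · simp
    · intro y _ hy
      rw [indicator_of_notMem (fun h => hy (by simpa using h.symm)), mul_zero]
    · intro h
      exact absurd (s.mem_range_self x) h
  rw [e]
  refine (hf.2 _ _).trans (mul_le_mul_of_nonneg_left ?_ hf.1)
  rw [norm_sub_rev]
  exact hs x hx

/-- Almost surely, the empirical measures converge in the Kantorovich sense. -/
theorem ae_eventually_kantorovichLE {R : ℝ} (hμ₀ : ProbOnBall R μ₀)
    (hlaw : ∀ N i, HasLaw (X N i) μ₀ P)
    (hindep : ∀ N, iIndepFun (X N) P) :
    ∀ᵐ ω ∂P, (∀ N i, ‖X N i ω‖ ≤ R) → ∀ δ : ℝ, 0 < δ → ∀ᶠ N : ℕ in atTop,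
      KantorovichLE (empiricalMeasure fun i => X N i ω) μ₀ δ := by
  have := hμ₀.prob
  suffices h : ∀ k : ℕ, ∀ᵐ ω ∂P, (∀ N i, ‖X N i ω‖ ≤ R) → ∀ᶠ N : ℕ in atTop,
      KantorovichLE (empiricalMeasure fun i => X N i ω) μ₀ (1 / ((k : ℝ) + 1)) by
    filter_upwards [ae_all_iff.2 h] with ω hω hR δ hδ
    obtain ⟨k, hk⟩ := exists_nat_one_div_lt hδ
    exact (hω k hR).mono fun N hN => hN.mono hk.le
  intro k
  set δ : ℝ := 1 / ((k : ℝ) + 1) with hδ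
  have hδ0 : 0 < δ := by positivity
  obtain ⟨s, hs⟩ := exists_simpleFunc_near (d := d) R (η := δ / 4) (by positivity)
  -- The partition depends only on `R` and `δ`, so one null set serves all test functions
  -- simultaneously.
  have h : ∀ᵐ ω ∂P, ∀ y ∈ s.range, Tendsto (fun N : ℕ =>
      ∫ x, (s ⁻¹' {y}).indicator (fun _ => (1 : ℝ)) x ∂(empiricalMeasure fun i => X N i ω)) atTop
      (𝓝 (∫ x, (s ⁻¹' {y}).indicator (fun _ => (1 : ℝ)) x ∂μ₀)) :=
    (ae_ball_iff s.range.countable_toSet).2 fun y _ =>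
      ae_tendsto_integral_indicator hlaw hindep (s.measurableSet_preimage {y})
  filter_upwards [h] with ω hω hR
  have hlim : Tendsto (fun N : ℕ => ∑ y ∈ s.range, ‖y‖ *
      |∫ x, (s ⁻¹' {y}).indicator (fun _ => (1 : ℝ)) x ∂(empiricalMeasure fun i => X N i ω)
        - ∫ x, (s ⁻¹' {y}).indicator (fun _ => (1 : ℝ)) x ∂μ₀|) atTop
      (𝓝 (∑ y ∈ s.range, ‖y‖ * |∫ x, (s ⁻¹' {y}).indicator (fun _ => (1 : ℝ)) x ∂μ₀
        - ∫ x, (s ⁻¹' {y}).indicator (fun _ => (1 : ℝ)) x ∂μ₀|)) :=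
    tendsto_finsetSum _ fun y hy => (((hω y hy).sub_const _).abs).const_mul _
  simp only [sub_self, abs_zero, mul_zero, Finset.sum_const_zero] at hlim
  filter_upwards [hlim.eventually (gt_mem_nhds (half_pos hδ0)), eventually_ge_atTop 1] with N hN hN1
  have hp := probOnBall_empiricalMeasure hN1 (hR N)
  have := hp.prob
  intro K f hf
  set ν := empiricalMeasure fun i => X N i ω
  -- Subtracting `f 0` changes no difference of integrals and makes the coefficients at most `K
  -- ‖y‖`. The error budget is `δ/4` for each discretization and `δ/2` for the cell masses.
  have hg : IsLip K fun x => f x - f 0 := ⟨hf.1, fun x y => by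
    rw [sub_sub_sub_cancel_right]; exact hf.2 x y⟩
  have b1 := hp.abs_integral_sub_sum_le s hs hg
  have b2 := hμ₀.abs_integral_sub_sum_le s hs hg
  rw [integral_sub (hp.integrable hf.continuous) (integrable_const _)] at b1
  rw [integral_sub (hμ₀.integrable hf.continuous) (integrable_const _)] at b2
  simp only [integral_const, probReal_univ, one_smul] at b1 b2
  have b3 : ∑ y ∈ s.range, (f y - f 0) * ∫ x, (s ⁻¹' {y}).indicator (fun _ => (1 : ℝ)) x ∂ν
      - ∑ y ∈ s.range, (f y - f 0) * ∫ x, (s ⁻¹' {y}).indicator (fun _ => (1 : ℝ)) x ∂μ₀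
      ≤ K * (δ / 2) := by
    rw [← Finset.sum_sub_distrib]
    refine le_trans ?_ (mul_le_mul_of_nonneg_left hN.le hf.1)
    rw [Finset.mul_sum]
    refine Finset.sum_le_sum fun y _ => ?_
    rw [← mul_sub, ← mul_assoc]
    refine (le_abs_self _).trans ?_
    rw [abs_mul]
    refine mul_le_mul_of_nonneg_right ?_ (abs_nonneg _)
    have := hf.2 y 0
    rwa [sub_zero, Real.norm_eq_abs] at this
  rw [abs_le] at b1 b2
  linarith [b1.2, b2.1]

end Sampling

/-! ### Minimizers of the discrete error functional -/

section Minimizers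

variable {d : ℕ} {a : ℝ → ℝ} {T R M S L : ℝ} {μ₀ : Measure (EuclideanSpace ℝ (Fin d))}
  {μ : ℝ → Measure (EuclideanSpace ℝ (Fin d))}

/-- The factor by which the Kantorovich distance of the initial data controls the difference of
the error functionals on `X_{M,K}`. -/
noncomputable def stabilityConstant (T R M S L : ℝ) : ℝ :=
  4 * (M * (2 * R) + M * (2 * R)) * (2 * (M + 2 * R * M)) * Real.exp (2 * (S + 2 * R * L) * T)

lemma stabilityConstant_pos (hR : 0 < R) (hM : 0 < M) : 0 < stabilityConstant T R M S L := by
  unfold stabilityConstant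
  positivity

/-- The error of a minimizer is controlled by the best approximation in the hypothesis space and
by the distance of the initial data. -/
lemma errorFunctional_le_of_isMinOn (hT : 0 < T) (hM : 0 < M) (hR : IsConfiningRadius a T μ₀ R)
    (hμ : IsMeanFieldSolution a T μ₀ μ) (ha : BoundedLipschitz (2 * R) S L a) (haM : S + L ≤ M)
    {N : ℕ} (hN : 1 ≤ N) {x₀ : Fin N → EuclideanSpace ℝ (Fin d)} (hx₀ : ∀ i, x₀ i ∈ μ₀.support)
    {x : Fin N → ℝ → EuclideanSpace ℝ (Fin d)} (hx : IsParticleSolution a T x₀ x)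
    {V : Set (ℝ → ℝ)} (hV : V ⊆ BoundedKernels M R) {b bN : ℝ → ℝ} (hb : b ∈ V)
    (hmin : IsMinOn (discreteErrorFunctional a T x) V b) (hbN : bN ∈ V) {ε δ : ℝ}
    (hε : ∀ s ∈ Icc 0 (2 * R), |bN s - a s| ≤ ε) (hδ : 0 ≤ δ)
    (h0 : KantorovichLE (empiricalMeasure x₀) μ₀ δ) :
    errorFunctional a T μ b
      ≤ ENNReal.ofReal (2 * (2 * R * ε) ^ 2 + stabilityConstant T R M S L * δ) := by
  obtain ⟨S', L', hSL', hb'⟩ := exists_boundedLipschitz_of_mem_boundedKernels hR.pos hM (hV hb)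
  obtain ⟨S₁, L₁, -, hbN'⟩ := exists_boundedLipschitz_of_mem_boundedKernels hR.pos hM (hV hbN)
  have hμc := hμ.weakCurve hR
  have hνc : WeakCurve (force (clampExtend (2 * R) a)) T R
      (fun t => empiricalMeasure fun i => x i t) :=
    hx.weakCurve hN fun i t ht => by simpa using hR.particles N x₀ hx₀ x hx i t ht
  have hinit : KantorovichLE (μ 0) (empiricalMeasure fun i => x i 0) δ := by
    rw [hμ.initial, funext hx.1]
    exact h0.symm
  have hstab : ∀ t ∈ Icc 0 T, KantorovichLE (μ t) (empiricalMeasure fun i => x i t)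
      (Real.exp (2 * (S + 2 * R * L) * T) * δ) := fun t ht =>
    hμc.stability hνc (ha.forceBound hR.pos) hδ hinit ht
  have h1 := errorFunctional_le_add hT hR.pos ha haM hb' hSL' hμc.probOnBall hνc.probOnBall
    (by positivity) hstab
  have h2 : errorFunctional a T (fun t => empiricalMeasure fun i => x i t) b
      ≤ errorFunctional a T (fun t => empiricalMeasure fun i => x i t) bN := by
    rw [← discreteErrorFunctional_eq, ← discreteErrorFunctional_eq]
    exact hmin hbN
  -- The approximant is compared with `a`, whose error vanishes along every curve; hence the factor
  -- two costs nothing.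
  have h3 := errorFunctional_le_two_mul_add hT hR.pos ha hbN' ha hνc.probOnBall hε
  rw [errorFunctional_self, mul_zero, zero_add] at h3
  have hc : 0 < stabilityConstant T R M S L := stabilityConstant_pos hR.pos hM
  rw [ENNReal.ofReal_add (by positivity) (by positivity)]
  refine h1.trans (add_le_add (h2.trans h3) (ENNReal.ofReal_le_ofReal (le_of_eq ?_)))
  unfold stabilityConstant
  ring

lemma ProbOnBall.of_isConfiningRadius (hT : 0 < T) (hR : IsConfiningRadius a T μ₀ R)
    (hμ : IsMeanFieldSolution a T μ₀ μ) : ProbOnBall R μ₀ := by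
  rw [← hμ.initial]
  exact (hμ.weakCurve hR).probOnBall 0 ⟨le_rfl, hT.le⟩

/-- The confining radius controls only trajectories that start in the support. -/
lemma ae_forall_mem_support [IsProbabilityMeasure μ₀] {Ω : Type*} [MeasurableSpace Ω]
    {P : Measure Ω} {X : (N : ℕ) → Fin N → Ω → EuclideanSpace ℝ (Fin d)}
    (hlaw : ∀ N i, HasLaw (X N i) μ₀ P) : ∀ᵐ ω ∂P, ∀ N i, X N i ω ∈ μ₀.support := by
  refine ae_all_iff.2 fun N => ae_all_iff.2 fun i => ?_
  have h : ∀ᵐ x ∂μ₀, x ∈ μ₀.support := Measure.support_mem_ae_of_regular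
  rw [← (hlaw N i).map_eq] at h
  have := ae_of_ae_map (hlaw N i).aemeasurable h
  rw [(hlaw N i).map_eq] at this
  exact this

lemma abs_sub_le_of_supNormOn_le {b b₁ : ℝ → ℝ} {r C : ℝ} (hr : 0 < r) (hC : 0 ≤ C)
    (hb : ContinuousOn b (Icc 0 r)) (hb₁ : ContinuousOn b₁ (Icc 0 r))
    (h : supNormOn (fun s => b s - b₁ s) (Icc 0 r) ≤ ENNReal.ofReal C) :
    ∀ s ∈ Icc 0 r, |b s - b₁ s| ≤ C :=
  abs_le_of_ae_restrict_Icc hr (hb.sub hb₁)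
    ((ae_norm_le_toReal_supNormOn (ne_top_of_le_ne_top ENNReal.ofReal_ne_top h)).mono
      fun _ hs => hs.trans (ENNReal.toReal_le_of_le_ofReal hC h))

lemma eventually_forall_abs_sub_le {f : ℕ → ℝ → ℝ} {b : ℝ → ℝ} {s : Set ℝ}
    (h : TendstoUniformlyOn f b atTop s) {ε : ℝ} (hε : 0 < ε) :
    ∀ᶠ n in atTop, ∀ t ∈ s, |f n t - b t| ≤ ε :=
  (Metric.tendstoUniformlyOn_iff.1 h ε hε).mono fun n hn t ht => by
    rw [abs_sub_comm]; exact (hn t ht).le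

lemma exists_pos_quadratic_lt {A C η : ℝ} (hη : 0 < η) : ∃ e : ℝ, 0 < e ∧ A * e ^ 2 + C * e < η := by
  have hc : Continuous fun e : ℝ => A * e ^ 2 + C * e := by fun_prop
  have ht : Tendsto (fun e : ℝ => A * e ^ 2 + C * e) (𝓝[>] 0) (𝓝 (A * 0 ^ 2 + C * 0)) :=
    (hc.tendsto 0).mono_left nhdsWithin_le_nhds
  have hlt : A * (0 : ℝ) ^ 2 + C * 0 < η := by simpa using hη
  exact (eventually_mem_nhdsWithin.and (ht.eventually (gt_mem_nhds hlt))).exists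

lemma tendsto_zero_of_sq_tendsto_zero {f : ℕ → ℝ≥0∞} (h : Tendsto (fun n => f n ^ 2) atTop (𝓝 0)) :
    Tendsto f atTop (𝓝 0) := by
  have h1 := ((ENNReal.continuous_rpow_const (y := 1 / 2)).tendsto 0).comp h
  rw [ENNReal.zero_rpow_of_pos (by norm_num)] at h1
  refine h1.congr fun n => ?_
  simp only [Function.comp]
  rw [← ENNReal.rpow_natCast, ← ENNReal.rpow_mul]
  norm_num

/-- Since `ρ` is carried by `K`, a kernel continuous on `K` alone agrees almost everywhere with its
clamped extension, which supplies the measurability. -/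
lemma ae_eq_of_eLpNorm_sub_eq_zero {b : ℝ → ℝ} (hR : 0 < R)
    (hμ : ∀ t ∈ Icc 0 T, ProbOnBall R (μ t)) (ha : ContinuousOn a (Icc 0 (2 * R)))
    (hb : ContinuousOn b (Icc 0 (2 * R))) (h : eLpNorm (fun s => a s - b s) 2 (rho T μ) = 0) :
    b =ᵐ[rho T μ] a := by
  have hr : 0 < 2 * R := by positivity
  have hm : ∀ {f : ℝ → ℝ}, ContinuousOn f (Icc 0 (2 * R)) → AEStronglyMeasurable f (rho T μ) :=
    fun {f} hf => (continuous_clampExtend hr hf).aestronglyMeasurable.congr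
      ((rho_ae_mem_Icc hμ).mono fun s hs => (clampExtend_eqOn f hs).symm)
  have h0 := (eLpNorm_eq_zero_iff ((hm ha).sub (hm hb)) (by norm_num)).1 h
  filter_upwards [h0] with s hs
  simpa [sub_eq_zero, eq_comm] using hs

end Minimizers

end KernelLearning

/-! ### The main theorem -/

/-- In both parts `x N` are the trajectories of the `N` particles started at the sample
`X N 0 ω, …, X N (N-1) ω`, and `aHat N` is a minimizer of the discrete error functional on `V N`.
All hypotheses and conclusions involving `N` are about `N ≥ 1`. -/
theorem theorem1p3 {d : ℕ} (T : ℝ) (hT : 0 < T)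
    -- the kernel, its weak derivative, the initial law, `K = [0, 2R]` and `M`
    (a a' : ℝ → ℝ) (ha : a ∈ Admissible) (ha' : HasWeakDerivOn a a' (Ioi 0))
    (μ₀ : Measure (EuclideanSpace ℝ (Fin d))) [IsProbabilityMeasure μ₀]
    (hμ₀ : IsCompact μ₀.support)
    (R : ℝ) (hR : IsConfiningRadius a T μ₀ R)
    (M : ℝ) (hM : 0 < M)
    (haM : supNormOn a (Icc 0 (2 * R)) + supNormOn a' (Icc 0 (2 * R)) ≤ ENNReal.ofReal M)
    -- the mean-field solution
    (μ : ℝ → Measure (EuclideanSpace ℝ (Fin d))) (hμ : IsMeanFieldSolution a T μ₀ μ)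
    -- for every `N`, a sample of `N` independent points with law `μ₀`
    {Ω : Type*} [MeasurableSpace Ω] (P : Measure Ω) [IsProbabilityMeasure P]
    (X : (N : ℕ) → Fin N → Ω → EuclideanSpace ℝ (Fin d))
    (hlaw : ∀ N i, HasLaw (X N i) μ₀ P)
    (hindep : ∀ N, iIndepFun (X N) P) :
    -- convergence of a subsequence, and identification of the limit under coercivity
    (∀ᵐ ω ∂P, ∀ (x : (N : ℕ) → Fin N → ℝ → EuclideanSpace ℝ (Fin d))
        (V : ℕ → Set (ℝ → ℝ)) (aHat : ℕ → ℝ → ℝ),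
      (∀ N, 1 ≤ N → IsParticleSolution a T (fun i => X N i ω) (x N)) →
      UniformApproximationProperty M R V →
      (∀ N, 1 ≤ N → aHat N ∈ V N ∧
        IsMinOn (discreteErrorFunctional a T (x N)) (V N) (aHat N)) →
      ∃ n : ℕ → ℕ, StrictMono n ∧ ∃ b ∈ BoundedKernels M R,
        TendstoUniformlyOn (fun k => aHat (n k)) b atTop (Icc 0 (2 * R)) ∧
        errorFunctional a T μ b = 0 ∧
        ∀ c : ℝ, 0 < c → Coercive a T μ c → b =ᵐ[rho T μ] a) ∧
    -- rate of convergence and convergence of the whole sequence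
    (∀ c : ℝ, 0 < c → Coercive a T μ c →
      ∀ α β C₁ C₂ : ℝ, 0 < α → 0 < β → 0 < C₁ → 0 < C₂ → ∃ C₃ : ℝ, 0 < C₃ ∧
      ∀ᵐ ω ∂P, ∀ (x : (N : ℕ) → Fin N → ℝ → EuclideanSpace ℝ (Fin d))
          (V : ℕ → Set (ℝ → ℝ)) (aHat aN : ℕ → ℝ → ℝ),
        (∀ N, 1 ≤ N → IsParticleSolution a T (fun i => X N i ω) (x N)) →
        UniformApproximationProperty M R V →
        (∀ N, 1 ≤ N → aHat N ∈ V N ∧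
          IsMinOn (discreteErrorFunctional a T (x N)) (V N) (aHat N)) →
        (∀ N, 1 ≤ N → aN N ∈ V N) →
        (∀ N, 1 ≤ N → supNormOn (fun s => a s - aN N s) (Icc 0 (2 * R)) ≤
          ENNReal.ofReal (C₁ * (N : ℝ) ^ (-α))) →
        (∀ N, 1 ≤ N → W₁ (empiricalMeasure (fun i => X N i ω)) μ₀ ≤
          ENNReal.ofReal (C₂ * (N : ℝ) ^ (-β))) →
        (∀ N, 1 ≤ N → eLpNorm (fun s => a s - aHat N s) 2 (rho T μ) ^ 2 ≤
          ENNReal.ofReal (C₃ * (N : ℝ) ^ (-min α β))) ∧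
        Tendsto (fun N => eLpNorm (fun s => a s - aHat N s) 2 (rho T μ)) atTop (𝓝 0)) := by
  have hRpos := hR.pos
  have hr : 0 < 2 * R := by positivity
  have haK : ContinuousOn a (Icc 0 (2 * R)) := ha.1.mono Icc_subset_Ici_self
  obtain ⟨S, L, hSL, haB⟩ :=
    (ha'.mono Ioo_subset_Ioi_self).boundedLipschitz hr haK hM.le haM
  have haM' : a ∈ BoundedKernels M R := haB.mem_boundedKernels hRpos hSL
  have hμp := (hμ.weakCurve hR).probOnBall
  have hμ₀p : ProbOnBall R μ₀ := ProbOnBall.of_isConfiningRadius hT hR hμ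
  have hμ₀s : μ₀.support ⊆ Metric.closedBall 0 R := by
    have := hR.meanField μ hμ 0 ⟨le_rfl, hT.le⟩
    rwa [hμ.initial] at this
  have hC : 0 < stabilityConstant T R M S L := stabilityConstant_pos hRpos hM
  set C := stabilityConstant T R M S L
  constructor
  · filter_upwards [ae_forall_mem_support hlaw, ae_eventually_kantorovichLE hμ₀p hlaw hindep]
      with ω hsupp hconv x V aHat hx hV hmin
    have hconv := hconv fun N i => by simpa using hμ₀s (hsupp N i)
    obtain ⟨aN, haN, haNlim⟩ := hV.2 a haM'
    have hE : ∀ η : ℝ, 0 < η →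
        ∀ᶠ N in atTop, errorFunctional a T μ (aHat N) ≤ ENNReal.ofReal η := by
      intro η hη
      -- The same `e` serves as approximation error and as distance of the initial data.
      obtain ⟨e, he, hlt⟩ := exists_pos_quadratic_lt (A := 2 * (2 * R) ^ 2) (C := C) hη
      filter_upwards [hconv e he, eventually_forall_abs_sub_le haNlim he, eventually_ge_atTop 1]
        with N hN1 hN2 hN
      refine (errorFunctional_le_of_isMinOn hT hM hR hμ haB hSL hN (hsupp N) (hx N hN)
        (hV.1 N hN) (hmin N hN).1 (hmin N hN).2 (haN N hN) hN2 he.le hN1).trans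
        (ENNReal.ofReal_le_ofReal ?_)
      refine le_trans (le_of_eq ?_) hlt.le
      ring
    -- The shift by one avoids `N = 0`, about which nothing is assumed.
    obtain ⟨φ, hφ, b, hb, hlim⟩ := exists_subseq_tendstoUniformlyOn hRpos hM
      (f := fun n => aHat (n + 1)) fun n => hV.1 _ (by omega) (hmin _ (by omega)).1
    have hn : StrictMono fun k => φ k + 1 := fun i j hij => Nat.succ_lt_succ (hφ hij)
    obtain ⟨S', L', -, hbB⟩ := exists_boundedLipschitz_of_mem_boundedKernels hRpos hM hb
    have hEb : errorFunctional a T μ b = 0 := by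
      refine le_antisymm ?_ zero_le
      have hη : ∀ η : ℝ, 0 < η → errorFunctional a T μ b
          ≤ 2 * ENNReal.ofReal η + ENNReal.ofReal (2 * (2 * R * η) ^ 2) := by
        intro η hη
        obtain ⟨k, hk1, hk2⟩ := ((hn.tendsto_atTop.eventually (hE η hη)).and
          (eventually_forall_abs_sub_le hlim hη)).exists
        obtain ⟨S₁, L₁, -, hB₁⟩ := exists_boundedLipschitz_of_mem_boundedKernels hRpos hM
          (hV.1 (φ k + 1) (by omega) (hmin (φ k + 1) (by omega)).1)
        refine (errorFunctional_le_two_mul_add hT hRpos haB hbB hB₁ hμp fun s hs => ?_).trans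
          (add_le_add_left (mul_le_mul_right hk1 2) _)
        rw [abs_sub_comm]
        exact hk2 s hs
      have ht : Tendsto (fun η : ℝ => ENNReal.ofReal (2 * η + 2 * (2 * R * η) ^ 2)) (𝓝[>] 0)
          (𝓝 (ENNReal.ofReal (2 * 0 + 2 * (2 * R * 0) ^ 2))) := by
        refine (ENNReal.continuous_ofReal.tendsto _).comp ?_
        have : Continuous fun η : ℝ => 2 * η + 2 * (2 * R * η) ^ 2 := by fun_prop
        exact (this.tendsto 0).mono_left nhdsWithin_le_nhds
      have := ge_of_tendsto ht (eventually_mem_nhdsWithin.mono fun η (h : 0 < η) => by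
        have := hη η h
        rwa [two_mul_ofReal, ← ENNReal.ofReal_add (by positivity) (by positivity)] at this)
      simpa using this
    refine ⟨fun k => φ k + 1, hn, b, hb, hlim, hEb, fun c hc hcoer => ?_⟩
    have h1 := hcoer.mul_eLpNorm_sq_le hT hRpos hμp hbB
    rw [hEb, nonpos_iff_eq_zero, mul_eq_zero, or_iff_right (by simpa using hc)] at h1
    exact ae_eq_of_eLpNorm_sub_eq_zero hRpos hμp haK hb.1 (by simpa using h1)
  · intro c hc hcoer α β C₁ C₂ hα hβ hC₁ hC₂
    -- Approximation error plus sampling error, divided by the coercivity constant; it is fixed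
    -- before the realization and the hypothesis spaces.
    set C₃ := (2 * (2 * R * C₁) ^ 2 + C * C₂) / c with hC₃
    have hC₃0 : 0 < C₃ := by positivity
    refine ⟨C₃, hC₃0, ?_⟩
    filter_upwards [ae_forall_mem_support hlaw] with ω hsupp x V aHat aN hx hV hmin haN happ hW
    have hmain : ∀ N, 1 ≤ N → eLpNorm (fun s => a s - aHat N s) 2 (rho T μ) ^ 2 ≤
        ENNReal.ofReal (C₃ * (N : ℝ) ^ (-min α β)) := by
      intro N hN
      have hN1 : (1 : ℝ) ≤ N := by exact_mod_cast hN
      have hpα : 0 < (N : ℝ) ^ (-α) := by positivity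
      have hpβ : 0 < (N : ℝ) ^ (-β) := by positivity
      have hα1 : (N : ℝ) ^ (-α) ≤ 1 := Real.rpow_le_one_of_one_le_of_nonpos hN1 (by linarith)
      have hαm : (N : ℝ) ^ (-α) ≤ (N : ℝ) ^ (-min α β) :=
        Real.rpow_le_rpow_of_exponent_le hN1 (neg_le_neg (min_le_left _ _))
      have hβm : (N : ℝ) ^ (-β) ≤ (N : ℝ) ^ (-min α β) :=
        Real.rpow_le_rpow_of_exponent_le hN1 (neg_le_neg (min_le_right _ _))
      have hp₀ : ProbOnBall R (empiricalMeasure fun i => X N i ω) :=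
        probOnBall_empiricalMeasure hN fun i => by simpa using hμ₀s (hsupp N i)
      have hk := KantorovichLE.of_W₁_le hp₀ hμ₀p (by positivity) (hW N hN)
      have hε : ∀ s ∈ Icc 0 (2 * R), |aN N s - a s| ≤ C₁ * (N : ℝ) ^ (-α) := fun s hs => by
        rw [abs_sub_comm]
        exact abs_sub_le_of_supNormOn_le hr (by positivity) haK (hV.1 N hN (haN N hN)).1
          (happ N hN) s hs
      have h1 := errorFunctional_le_of_isMinOn hT hM hR hμ haB hSL hN (hsupp N) (hx N hN)
        (hV.1 N hN) (hmin N hN).1 (hmin N hN).2 (haN N hN) hε (by positivity) hk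
      obtain ⟨S', L', -, hB'⟩ := exists_boundedLipschitz_of_mem_boundedKernels hRpos hM
        (hV.1 N hN (hmin N hN).1)
      have h2 := (hcoer.mul_eLpNorm_sq_le hT hRpos hμp hB').trans h1
      rw [mul_comm, ← ENNReal.le_div_iff_mul_le (Or.inl (by simpa using hc))
        (Or.inl ENNReal.ofReal_ne_top), ← ENNReal.ofReal_div_of_pos hc] at h2
      refine h2.trans (ENNReal.ofReal_le_ofReal ?_)
      rw [hC₃, div_mul_eq_mul_div]
      refine div_le_div_of_nonneg_right ?_ hc.le
      -- The approximation error enters squared; as `N ^ (-α) ≤ 1`, one factor is dropped.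
      have hsq : ((N : ℝ) ^ (-α)) ^ 2 ≤ (N : ℝ) ^ (-min α β) := by nlinarith
      have t1 := mul_le_mul_of_nonneg_left hsq (by positivity : 0 ≤ 2 * (2 * R * C₁) ^ 2)
      have t2 := mul_le_mul_of_nonneg_left hβm (by positivity : 0 ≤ C * C₂)
      calc _ = 2 * (2 * R * C₁) ^ 2 * ((N : ℝ) ^ (-α)) ^ 2 + C * C₂ * (N : ℝ) ^ (-β) := by ring
        _ ≤ _ := by linarith
    refine ⟨hmain, tendsto_zero_of_sq_tendsto_zero ?_⟩
    have hpow : Tendsto (fun N : ℕ => ENNReal.ofReal (C₃ * (N : ℝ) ^ (-min α β))) atTop (𝓝 0) := by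
      have := ((tendsto_rpow_neg_atTop (lt_min hα hβ)).comp
        tendsto_natCast_atTop_atTop).const_mul C₃
      rw [mul_zero] at this
      simpa [Function.comp_def] using (ENNReal.continuous_ofReal.tendsto 0).comp this
    exact tendsto_of_tendsto_of_tendsto_of_le_of_le' tendsto_const_nhds hpow
      (Eventually.of_forall fun _ => zero_le) (eventually_atTop.2 ⟨1, hmain⟩)
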